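/- Let $\xi$ be a nonnegative random variable with $\mathsf E\xi\le 1$, let $F$ be its distribution function, and let $F^{-1}(r)=\inf\{x\ge 0: F(x)>r\}\in[0,\infty]$, $r\in[0,1]$, be the right-continuous inverse of $F$ (here $\inf\emptyset=+\infty$ throughout). Let $\mu_W$ be the Wiener measure on the space $C(\mathbb R_+)$ of real continuous functions on $[0,\infty)$ with its Borel $\sigma$-algebra, let $\mu_L$ be the Lebesgue measure on $[0,1]$, and put $$\Omega=C(\mathbb R_+)\times[0,1],\qquad \mathcal F=\mathcal B(C(\mathbb R_+))\otimes\mathcal B([0,1]),\qquad \mathsf P=\mu_W\times\mu_L .$$ For $\omega=(x,r)$ let $B_t(\omega)=x(t)$ and $R(\omega)=r$; let $\mathcal F_t=\bigcap_{\varepsilon>0}\sigma(R,B_s;\,s\in[0,t+\varepsilon])$ and $Y_t=e^{B_t-t/2}$ for $t\ge0$, and $Y_\infty=0$ (the almost sure limit of $Y_t$ as $t\to\infty$). For $r\in[0,1]$ let $$h(r)=\int_0^r F^{-1}(s)\,ds,\qquad g(r)=r-h(r),\qquad g^*=\max_{[0,1]}g .$$ For $c\in g([0,1])$ let $\theta_1(c)\le\theta_2(c)$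 be the smallest and the largest solution $\theta\in[0,1]$ of $g(\theta)=c$. Define $U,V\colon[0,1]\to[0,\infty]$ by - $U(\theta)=F^{-1}(\theta)$, $V(\theta)=+\infty$, if $g(\theta)<g(1)$; - $U(\theta)=F^{-1}(\theta_1(g(\theta)))$, $V(\theta)=F^{-1}(\theta_2(g(\theta)))$, if $g(1)\le g(\theta)<g^*$; - $U(\theta)=V(\theta)=1$, if $g(\theta)=g^*$. Put $\alpha=U(R)$, $\beta=V(R)$ and $$\tau=\inf\{t\ge 0:\ Y_t\notin(\alpha,\beta)\}\in[0,\infty].$$ Then $R$ is $\mathcal F_0$-measurable and uniformly distributed on $[0,1]$; $B$ is an $(\mathcal F_t,\mathsf P)$-Brownian motion; $\tau$ is an $(\mathcal F_t)$-stopping time; and $Y_\tau$ has the same law as $\xi$. -/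

import Mathlib

open MeasureTheory ProbabilityTheory
open scoped NNReal ENNReal unitInterval

noncomputable section

namespace GBMEmbedding

/-! ### The filtered probability space -/

/-- `C(ℝ₊)`: real continuous functions on `[0, ∞)`, with the topology of locally uniform
convergence (Mathlib's compact-open topology). -/
abbrev PathSpace : Type := C(ℝ≥0, ℝ)

instance instMeasurableSpacePathSpace : MeasurableSpace PathSpace := borel PathSpace

instance instBorelSpacePathSpace : BorelSpace PathSpace := ⟨rfl⟩

/-- `μ` is the Wiener measure on `C(ℝ₊)`: under `μ` the coordinate process is a standard Brownian
motion (started at `0`). This determines all finite-dimensional distributions of `μ`, hence `μ`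
itself, since the Borel σ-algebra of `C(ℝ₊)` is generated by the coordinates. -/
def IsWienerMeasure (μ : Measure PathSpace) : Prop :=
  IsBrownianReal (fun (t : ℝ≥0) (x : PathSpace) ↦ x t) μ

/-- `Ω = C(ℝ₊) × [0, 1]`, with the product of the Borel σ-algebras. -/
abbrev Omega : Type := PathSpace × I

/-- `R (x, r) = r`. -/
def R (ω : Omega) : I := ω.2

/-- `B_t (x, r) = x t`. -/
def B (t : ℝ≥0) (ω : Omega) : ℝ := ω.1 t

/-- `P = μ_W × μ_L`, the product of the measure `μW` on paths (the Wiener measure in the theorem)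
and the Lebesgue measure on `[0, 1]`. -/
def productMeasure (μW : Measure PathSpace) : Measure Omega := μW.prod volume

/-- `σ(R, B_s ; s ∈ [0, u])`. -/
@[reducible]
def sigmaUpTo (u : ℝ≥0) : MeasurableSpace Omega :=
  MeasurableSpace.comap R inferInstance ⊔
    ⨆ (s : ℝ≥0) (_ : s ≤ u), MeasurableSpace.comap (B s) inferInstance

lemma sigmaUpTo_mono {u v : ℝ≥0} (huv : u ≤ v) : sigmaUpTo u ≤ sigmaUpTo v := by
  unfold sigmaUpTo
  exact sup_le le_sup_left <| iSup₂_le fun s hs ↦ le_sup_of_le_right <|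
    le_iSup₂ (f := fun (s : ℝ≥0) (_ : s ≤ v) ↦ MeasurableSpace.comap (B s) inferInstance)
      s (hs.trans huv)

lemma sigmaUpTo_le (u : ℝ≥0) : sigmaUpTo u ≤ (inferInstance : MeasurableSpace Omega) := by
  refine sup_le (Measurable.comap_le measurable_snd) (iSup₂_le fun s _ ↦ Measurable.comap_le ?_)
  have h : Measurable fun x : PathSpace ↦ x s := (continuous_eval_const s).measurable
  exact h.comp measurable_fst

/-- `𝓕_t = ⋂_{ε > 0} σ(R, B_s ; s ∈ [0, t + ε])`. -/
def filtration : Filtration ℝ≥0 (inferInstance : MeasurableSpace Omega) where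
  seq t := ⨅ (ε : ℝ≥0) (_ : 0 < ε), sigmaUpTo (t + ε)
  mono' _ _ hst := iInf₂_mono fun ε _ ↦ sigmaUpTo_mono (by gcongr)
  le' t := (iInf₂_le 1 one_pos).trans (sigmaUpTo_le (t + 1))

/-- `X` is a Brownian motion with respect to the filtration `𝓕` and the probability `P`. -/
structure IsBrownianWrt {Ω : Type*} {m : MeasurableSpace Ω} (X : ℝ≥0 → Ω → ℝ)
    (𝓕 : Filtration ℝ≥0 m) (P : Measure Ω) : Prop where
  isBrownian : IsBrownianReal X P
  adapted : Adapted 𝓕 X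
  indep : ∀ s t : ℝ≥0, s ≤ t →
    Indep (MeasurableSpace.comap (fun ω ↦ X t ω - X s ω) inferInstance) (𝓕 s) P

/-- The geometric Brownian motion `Y_t = exp (B_t - t / 2)`. -/
def Y (t : ℝ≥0) (ω : Omega) : ℝ := Real.exp (B t ω - (t : ℝ) / 2)

open Classical in
/-- `Y_τ` for a `[0, ∞]`-valued time `τ`: it is `Y_{τ(ω)}(ω)` if `τ(ω) < ∞`, and `0` if
`τ(ω) = ∞`, because `Y_∞ = 0` is the almost sure limit of `Y_t` as `t → ∞`. -/
def stoppedY (τ : Omega → WithTop ℝ≥0) (ω : Omega) : ℝ :=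
  if τ ω = ⊤ then 0 else stoppedValue Y τ ω

/-! ### The construction of the levels from the law `ν` on `[0, ∞)` -/

/-- The right-continuous inverse `F⁻¹(r) = inf {x ∈ ℝ₊ | F(x) > r} ∈ [0, ∞]` of the distribution
function `F` of `ν`, with `inf ∅ = ∞`. -/
def quantile (ν : Measure ℝ) (r : ℝ) : ℝ≥0∞ :=
  ⨅ (x : ℝ≥0) (_ : r < cdf ν x), (x : ℝ≥0∞)

/-- `h(r) = ∫_0^r F⁻¹(s) ds`. -/
def h (ν : Measure ℝ) (r : ℝ) : ℝ≥0∞ := ∫⁻ s in Set.Ioc 0 r, quantile ν s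

/-- `g(r) = r - h(r)`; when `ν` has mean at most `1`, `h` is finite on `[0, 1]`. -/
def g (ν : Measure ℝ) (r : ℝ) : ℝ := r - (h ν r).toReal

/-- `g* = max_{[0, 1]} g`. -/
def gMax (ν : Measure ℝ) : ℝ := sSup (g ν '' Set.Icc 0 1)

/-- The smallest solution `θ₁` in `[0, 1]` of `g(θ) = c`. -/
def theta1 (ν : Measure ℝ) (c : ℝ) : ℝ := sInf {θ ∈ Set.Icc (0 : ℝ) 1 | g ν θ = c}

/-- The largest solution `θ₂` in `[0, 1]` of `g(θ) = c`. -/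
def theta2 (ν : Measure ℝ) (c : ℝ) : ℝ := sSup {θ ∈ Set.Icc (0 : ℝ) 1 | g ν θ = c}

open Classical in
/-- The lower level: `F⁻¹(θ)` if `g(θ) < g(1)`; `F⁻¹(θ₁)` if `g(1) ≤ g(θ) < g*`, with `θ₁` the
smaller solution of `g(θ₁) = g(θ)`; and `1` if `g(θ) = g*`. -/
def U (ν : Measure ℝ) (θ : ℝ) : ℝ≥0∞ :=
  if g ν θ < g ν 1 then quantile ν θ
  else if g ν θ < gMax ν then quantile ν (theta1 ν (g ν θ))
  else 1

open Classical in
/-- The upper level: `∞` if `g(θ) < g(1)`; `F⁻¹(θ₂)` if `g(1) ≤ g(θ) < g*`, with `θ₂` the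
larger solution of `g(θ₂) = g(θ)`; and `1` if `g(θ) = g*`. -/
def V (ν : Measure ℝ) (θ : ℝ) : ℝ≥0∞ :=
  if g ν θ < g ν 1 then ∞
  else if g ν θ < gMax ν then quantile ν (theta2 ν (g ν θ))
  else 1

/-- `α = U(R)`. -/
def α (ν : Measure ℝ) (ω : Omega) : ℝ≥0∞ := U ν (R ω)

/-- `β = V(R)`. -/
def β (ν : Measure ℝ) (ω : Omega) : ℝ≥0∞ := V ν (R ω)

/-- `τ = inf {t ∈ ℝ₊ | Y_t ∉ (α, β)} ∈ [0, ∞]`, with `inf ∅ = ∞`. -/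
def exitTime (ν : Measure ℝ) (ω : Omega) : WithTop ℝ≥0 :=
  ⨅ (t : ℝ≥0) (_ : ENNReal.ofReal (Y t ω) ∉ Set.Ioo (α ν ω) (β ν ω)), (t : WithTop ℝ≥0)

end GBMEmbedding

end

/-!
The proof has an analytic and a probabilistic half, which meet in the notion of *exit law*: the law
`δ_1` for `a = b = 1`, `δ_a` for `a < 1`, `b = ∞`, and the two-point law on `{a, b}` with mean `1`
for `a < 1 < b < ∞` (`exitMean`).

*Analysis.* `F⁻¹` of a uniform variable has law `ν` (`map_toReal_quantile`), so the task is to show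
that mixing the exit laws of `(U(θ), V(θ))` over `θ` gives the same as mixing the Dirac masses at
`F⁻¹(θ)` (`IsAdmissible.lintegral_exitMean`). Where `F⁻¹ < 1` the function `g` increases and
`θ = θ₁(g(θ))`; where `F⁻¹ > 1` and `g < g*` it decreases and `θ = θ₂(g(θ))`; where `g = g*`, almost
surely `F⁻¹ = 1` (`IsAdmissible.ae_cases`). For `g(θ) < g(1)` and `g(θ) = g*` the exit law is
already the Dirac mass at `F⁻¹(θ)`. On `{g(1) < g < g*}`, with `a = F⁻¹(θ₁(c))`, `b = F⁻¹(θ₂(c))`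
and `c = g(θ)`, the two integrands differ by `(1 - F⁻¹(θ)) φ(g(θ))` with
`φ = (f(b) - f(a)) / (b - a)`, and such an expression integrates to `0`: `1 - F⁻¹ = g'`, and each
superlevel set of `g` is an interval at whose endpoints `g` takes the same value
(`IsAdmissible.setLIntegral_superlevel`, `IsAdmissible.setLIntegral_comp_g`). Since all integrals
are taken in `[0, ∞]`, positive and negative parts are kept on separate sides.

*Probability.* An increment of `B` after `s + ε` is independent of `σ(R, B_u; u ≤ s + ε)`, and
independence passes to the limit `ε → 0`, so `B` is a Brownian motion for the right-continuous
filtration (`IsWienerMeasure.isBrownianWrt`). The exit of a continuous path from an open interval is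
decided by its running infimum and supremum over countably many times, which makes `τ` a stopping
time (`isStoppingTime_firstExit`). For constant levels `a < 1 < b`, `Y` is a martingale, bounded up
to the exit time if `b < ∞`, and tends to `0` along the integers; optional stopping
(`integral_stopped_eq`) gives mean `1` at the exit, and therefore the exit law
(`lintegral_comp_stoppedY`). The independence of `R` and the path reduces the random levels to
constant ones by Fubini (`IsAdmissible.lintegral_stoppedY`).
-/

open MeasureTheory ProbabilityTheory
open scoped NNReal ENNReal unitInterval

noncomputable section

namespace GBMEmbedding

/-! ### The quantile function -/

section Quantile

variable {ν : Measure ℝ}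

lemma quantile_mono : Monotone (quantile ν) := fun _ _ hrs ↦
  le_iInf₂ fun x hx ↦ iInf₂_le x (hrs.trans_lt hx)

lemma measurable_quantile : Measurable (quantile ν) := quantile_mono.measurable

lemma quantile_le_of_lt_cdf {r : ℝ} {x : ℝ≥0} (hx : r < cdf ν x) : quantile ν r ≤ x :=
  iInf₂_le x hx

lemma quantile_lt_iff {r : ℝ} {y : ℝ≥0∞} :
    quantile ν r < y ↔ ∃ x : ℝ≥0, r < cdf ν x ∧ (x : ℝ≥0∞) < y := by
  simp [quantile, iInf_lt_iff]

lemma quantile_lt_top {r : ℝ} (hr : r < 1) : quantile ν r < ∞ := by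
  have h1 := (tendsto_cdf_atTop ν).eventually (lt_mem_nhds hr)
  obtain ⟨x, hx, hx0⟩ := (h1.and (Filter.eventually_ge_atTop 0)).exists
  lift x to ℝ≥0 using hx0
  exact (quantile_le_of_lt_cdf hx).trans_lt ENNReal.coe_lt_top

lemma le_cdf_of_quantile_le {r : ℝ} {x : ℝ≥0} (hx : quantile ν r ≤ x) : r ≤ cdf ν x := by
  have hc : Filter.Tendsto (cdf ν) (nhdsWithin (x : ℝ) (Set.Ioi x)) (nhds (cdf ν x)) :=
    ((cdf ν).right_continuous x).tendsto.mono_left (nhdsWithin_mono _ Set.Ioi_subset_Ici_self)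
  refine ge_of_tendsto hc ?_
  filter_upwards [self_mem_nhdsWithin] with y hy
  have hy : (x : ℝ) < y := hy
  have hy0 : 0 ≤ y := x.2.trans hy.le
  lift y to ℝ≥0 using hy0
  have hxy : (x : ℝ≥0∞) < y := by exact_mod_cast hy
  obtain ⟨z, hz, hzy⟩ := quantile_lt_iff.1 (hx.trans_lt hxy)
  exact hz.le.trans (monotone_cdf ν (by exact_mod_cast hzy.le))

/-- The quantile function is right-continuous, hence stays below `y` just to the right of a point
where it is below `y`. -/
lemma exists_gt_quantile_lt {r : ℝ} {y : ℝ≥0∞} (h : quantile ν r < y) :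
    ∃ s, r < s ∧ s < 1 ∧ quantile ν s < y := by
  obtain ⟨x, hx, hxy⟩ := quantile_lt_iff.1 h
  have := cdf_le_one ν x
  exact ⟨(r + cdf ν x) / 2, by linarith, by linarith,
    quantile_lt_iff.2 ⟨x, by linarith, hxy⟩⟩

/-- The quantile transform: `F⁻¹` of a uniform variable has distribution function `F`. -/
lemma map_toReal_quantile [IsProbabilityMeasure ν] (h0 : ∀ᵐ x ∂ν, 0 ≤ x) :
    (volume.restrict (Set.Ioo 0 1)).map (fun r ↦ (quantile ν r).toReal) = ν := by
  have hm : Measurable fun r ↦ (quantile ν r).toReal := measurable_quantile.ennreal_toReal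
  refine Measure.ext_of_Iic _ _ fun x ↦ ?_
  rw [Measure.map_apply hm measurableSet_Iic, Measure.restrict_apply (hm measurableSet_Iic),
    ← ofReal_cdf]
  rcases lt_or_ge x 0 with hx | hx
  · have h1 : cdf ν x = 0 := by
      rw [cdf_eq_real, measureReal_def, measure_eq_zero_iff_ae_notMem.2, ENNReal.toReal_zero]
      filter_upwards [h0] with y hy hyx
      exact absurd (hy.trans hyx) (not_le.2 hx)
    rw [h1, ENNReal.ofReal_zero]
    convert measure_empty (μ := volume)
    ext r
    simp only [Set.mem_inter_iff, Set.mem_preimage, Set.mem_Iic, Set.mem_empty_iff_false, iff_false]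
    exact fun h ↦ absurd (ENNReal.toReal_nonneg.trans h.1) (not_le.2 hx)
  lift x to ℝ≥0 using hx
  have hle : ∀ r ∈ Set.Ioo (0 : ℝ) 1, (quantile ν r).toReal ≤ x ↔ quantile ν r ≤ x := fun r hr ↦ by
    lift quantile ν r to ℝ≥0 using (quantile_lt_top hr.2).ne with y
    simp
  refine le_antisymm ?_ ?_
  · calc volume _ ≤ volume (Set.Ioc 0 (cdf ν x)) := by
          refine measure_mono fun r hr ↦ ⟨hr.2.1, ?_⟩
          exact le_cdf_of_quantile_le ((hle r hr.2).1 hr.1)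
      _ = _ := by simp
  · calc ENNReal.ofReal (cdf ν x) = volume (Set.Ioo 0 (cdf ν x)) := by simp
      _ ≤ _ := by
          refine measure_mono fun r hr ↦ ?_
          have hr1 : r ∈ Set.Ioo (0 : ℝ) 1 := ⟨hr.1, hr.2.trans_le (cdf_le_one ν x)⟩
          exact ⟨(hle r hr1).2 (quantile_le_of_lt_cdf hr.2), hr1⟩

lemma lintegral_comp_toReal_quantile [IsProbabilityMeasure ν] (h0 : ∀ᵐ x ∂ν, 0 ≤ x)
    {f : ℝ → ℝ≥0∞} (hf : Measurable f) :
    ∫⁻ r in Set.Ioo 0 1, f (quantile ν r).toReal = ∫⁻ x, f x ∂ν := by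
  conv_rhs => rw [← map_toReal_quantile h0]
  rw [lintegral_map hf measurable_quantile.ennreal_toReal]

end Quantile

/-! ### The function `g` is continuous and unimodal -/

/-- `ν` is a law on `[0, ∞)` with mean at most `1`. -/
structure IsAdmissible (ν : Measure ℝ) : Prop where
  isProbabilityMeasure : IsProbabilityMeasure ν
  nonneg : ∀ᵐ x ∂ν, 0 ≤ x
  mean_le_one : ∫⁻ x, ENNReal.ofReal x ∂ν ≤ 1

variable {ν : Measure ℝ}

lemma IsAdmissible.h_one_le (hν : IsAdmissible ν) : h ν 1 ≤ 1 := by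
  have := hν.isProbabilityMeasure
  refine le_trans (le_of_eq ?_) hν.mean_le_one
  rw [h, ← setLIntegral_congr Ioo_ae_eq_Ioc,
    ← lintegral_comp_toReal_quantile hν.nonneg ENNReal.measurable_ofReal]
  refine setLIntegral_congr_fun measurableSet_Ioo fun r hr ↦ ?_
  simp [ENNReal.ofReal_toReal (quantile_lt_top hr.2).ne]

lemma h_mono : Monotone (h ν) := fun _ _ hrs ↦
  lintegral_mono_set (Set.Ioc_subset_Ioc_right hrs)

lemma measurable_g : Measurable (g ν) :=
  measurable_id.sub h_mono.measurable.ennreal_toReal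

lemma IsAdmissible.h_ne_top (hν : IsAdmissible ν) {r : ℝ} (hr : r ≤ 1) : h ν r ≠ ∞ :=
  (((h_mono hr).trans hν.h_one_le).trans_lt ENNReal.one_lt_top).ne

lemma h_eq_add {s t : ℝ} (hs : 0 ≤ s) (hst : s ≤ t) :
    h ν t = h ν s + ∫⁻ r in Set.Ioo s t, quantile ν r := by
  rw [setLIntegral_congr Ioo_ae_eq_Ioc, h, h, ← lintegral_union measurableSet_Ioc,
    Set.Ioc_union_Ioc_eq_Ioc hs hst]
  exact Set.Ioc_disjoint_Ioc_of_le le_rfl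

lemma IsAdmissible.lintegral_quantile_ne_top (hν : IsAdmissible ν) {s t : ℝ} (hs : 0 ≤ s)
    (hst : s ≤ t) (ht : t ≤ 1) : ∫⁻ r in Set.Ioo s t, quantile ν r ≠ ∞ := fun hh ↦ by
  have h2 := hν.h_ne_top ht
  rw [h_eq_add hs hst, hh] at h2
  simp at h2

lemma IsAdmissible.g_sub (hν : IsAdmissible ν) {s t : ℝ} (hs : 0 ≤ s) (hst : s ≤ t) (ht : t ≤ 1) :
    g ν t - g ν s = (t - s) - (∫⁻ r in Set.Ioo s t, quantile ν r).toReal := by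
  have h1 := hν.h_ne_top (hst.trans ht)
  have h2 := hν.lintegral_quantile_ne_top hs hst ht
  rw [g, g, h_eq_add hs hst, ENNReal.toReal_add h1 h2]
  ring

lemma IsAdmissible.g_le_iff (hν : IsAdmissible ν) {s t : ℝ} (hs : 0 ≤ s) (hst : s ≤ t)
    (ht : t ≤ 1) : g ν s ≤ g ν t ↔ ∫⁻ r in Set.Ioo s t, quantile ν r ≤ volume (Set.Ioo s t) := by
  rw [← sub_nonneg, hν.g_sub hs hst ht, sub_nonneg, Real.volume_Ioo,
    ENNReal.le_ofReal_iff_toReal_le (hν.lintegral_quantile_ne_top hs hst ht) (by linarith)]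

lemma IsAdmissible.g_lt_iff (hν : IsAdmissible ν) {s t : ℝ} (hs : 0 ≤ s) (hst : s ≤ t)
    (ht : t ≤ 1) : g ν s < g ν t ↔ ∫⁻ r in Set.Ioo s t, quantile ν r < volume (Set.Ioo s t) := by
  rw [← sub_pos, hν.g_sub hs hst ht, sub_pos, Real.volume_Ioo,
    ENNReal.lt_ofReal_iff_toReal_lt (hν.lintegral_quantile_ne_top hs hst ht)]

lemma IsAdmissible.g_le_of_quantile_le_one (hν : IsAdmissible ν) {s t : ℝ} (hs : 0 ≤ s)
    (hst : s ≤ t) (ht : t ≤ 1) (hq : ∀ r ∈ Set.Ioo s t, quantile ν r ≤ 1) : g ν s ≤ g ν t := by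
  rw [hν.g_le_iff hs hst ht, ← setLIntegral_one]
  exact setLIntegral_mono measurable_const hq

lemma IsAdmissible.g_lt_of_quantile_lt_one (hν : IsAdmissible ν) {s t : ℝ} (hs : 0 ≤ s)
    (hst : s < t) (ht : t ≤ 1) (hq : ∀ r ∈ Set.Ioo s t, quantile ν r < 1) : g ν s < g ν t := by
  rw [hν.g_lt_iff hs hst.le ht, ← setLIntegral_one]
  exact setLIntegral_strict_mono measurableSet_Ioo (by simp [hst]) measurable_const
    (hν.lintegral_quantile_ne_top hs hst.le ht) (ae_of_all _ hq)

lemma IsAdmissible.g_ge_of_one_le_quantile (hν : IsAdmissible ν) {s t : ℝ} (hs : 0 ≤ s)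
    (hst : s ≤ t) (ht : t ≤ 1) (hq : ∀ r ∈ Set.Ioo s t, 1 ≤ quantile ν r) : g ν t ≤ g ν s := by
  rw [← not_lt, hν.g_lt_iff hs hst ht, ← setLIntegral_one, not_lt]
  exact setLIntegral_mono measurable_quantile hq

lemma IsAdmissible.g_gt_of_one_lt_quantile (hν : IsAdmissible ν) {s t : ℝ} (hs : 0 ≤ s)
    (hst : s < t) (ht : t ≤ 1) (hq : ∀ r ∈ Set.Ioo s t, 1 < quantile ν r) : g ν t < g ν s := by
  rw [← not_le, hν.g_le_iff hs hst.le ht, ← setLIntegral_one, not_le]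
  exact setLIntegral_strict_mono measurableSet_Ioo (by simp [hst]) measurable_quantile
    (by simp) (ae_of_all _ hq)

lemma IsAdmissible.continuousOn_g (hν : IsAdmissible ν) : ContinuousOn (g ν) (Set.Icc 0 1) := by
  have hfin : ∫⁻ r in Set.Ioo 0 1, quantile ν r ≠ ∞ :=
    hν.lintegral_quantile_ne_top le_rfl zero_le_one le_rfl
  have hint : IntegrableOn (fun r ↦ (quantile ν r).toReal) (Set.Icc 0 1) := by
    rw [integrableOn_Icc_iff_integrableOn_Ioo]
    exact integrable_toReal_of_lintegral_ne_top measurable_quantile.aemeasurable hfin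
  refine continuousOn_id.sub
    ((intervalIntegral.continuousOn_primitive hint).congr fun r hr ↦ ?_)
  change (h ν r).toReal = ∫ t in Set.Ioc 0 r, (quantile ν t).toReal
  rw [h, integral_toReal measurable_quantile.aemeasurable]
  rw [← restrict_Ioo_eq_restrict_Ioc]
  filter_upwards [ae_restrict_mem measurableSet_Ioo] with x hx
  exact quantile_lt_top (hx.2.trans_le hr.2)

lemma g_zero : g ν 0 = 0 := by simp [g, h]

lemma IsAdmissible.g_one_nonneg (hν : IsAdmissible ν) : 0 ≤ g ν 1 := by
  have := ENNReal.toReal_mono ENNReal.one_ne_top hν.h_one_le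
  rw [ENNReal.toReal_one] at this
  rw [g]; linarith

lemma IsAdmissible.exists_isMax (hν : IsAdmissible ν) :
    ∃ m ∈ Set.Icc (0 : ℝ) 1, g ν m = gMax ν ∧ ∀ θ ∈ Set.Icc (0 : ℝ) 1, g ν θ ≤ gMax ν := by
  obtain ⟨m, hm, hmax⟩ := isCompact_Icc.exists_isMaxOn (Set.nonempty_Icc.2 zero_le_one)
    hν.continuousOn_g
  have hg : IsGreatest (g ν '' Set.Icc 0 1) (g ν m) :=
    ⟨Set.mem_image_of_mem _ hm, Set.forall_mem_image.2 fun θ hθ ↦ hmax hθ⟩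
  refine ⟨m, hm, hg.csSup_eq.symm, fun θ hθ ↦ ?_⟩
  rw [gMax, hg.csSup_eq]
  exact hmax hθ

lemma IsAdmissible.g_le_gMax (hν : IsAdmissible ν) {θ : ℝ} (hθ : θ ∈ Set.Icc (0 : ℝ) 1) :
    g ν θ ≤ gMax ν := by
  obtain ⟨m, _, _, h⟩ := hν.exists_isMax
  exact h θ hθ

lemma IsAdmissible.g_lt_gMax (hν : IsAdmissible ν) {θ : ℝ} (hθ : 0 ≤ θ)
    (hq : quantile ν θ < 1) : g ν θ < gMax ν := by
  obtain ⟨s, hs, hs1, hqs⟩ := exists_gt_quantile_lt hq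
  refine (hν.g_lt_of_quantile_lt_one hθ hs hs1.le fun r hr ↦ ?_).trans_le
    (hν.g_le_gMax ⟨hθ.trans hs.le, hs1.le⟩)
  exact (quantile_mono hr.2.le).trans_lt hqs

lemma IsAdmissible.quantile_lt_one_of_g_lt (hν : IsAdmissible ν) {θ : ℝ}
    (hθ : θ ∈ Set.Icc (0 : ℝ) 1) (hg : g ν θ < g ν 1) : quantile ν θ < 1 := by
  by_contra! hq
  exact absurd (hν.g_ge_of_one_le_quantile hθ.1 hθ.2 le_rfl
    fun r hr ↦ hq.trans (quantile_mono hr.1.le)) (not_le.2 hg)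

lemma IsAdmissible.one_lt_quantile (hν : IsAdmissible ν) {θ : ℝ} (hθ : θ ∈ Set.Icc (0 : ℝ) 1)
    (hg : g ν θ < gMax ν) (hq : 1 ≤ quantile ν θ) : 1 < quantile ν θ := by
  obtain ⟨m, hm, hmg, -⟩ := hν.exists_isMax
  by_contra! hq1
  rcases le_total m θ with hmθ | hmθ
  · have := hν.g_le_of_quantile_le_one hm.1 hmθ hθ.2
      fun r hr ↦ (quantile_mono hr.2.le).trans hq1
    linarith
  · have := hν.g_ge_of_one_le_quantile hθ.1 hmθ hm.2
      fun r hr ↦ hq.trans (quantile_mono hr.1.le)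
    linarith

lemma IsAdmissible.theta1_g (hν : IsAdmissible ν) {θ : ℝ} (hθ : θ ∈ Set.Icc (0 : ℝ) 1)
    (hq : quantile ν θ < 1) : theta1 ν (g ν θ) = θ := by
  refine IsLeast.csInf_eq ⟨⟨hθ, rfl⟩, fun t ⟨ht, htg⟩ ↦ ?_⟩
  by_contra! htθ
  exact (hν.g_lt_of_quantile_lt_one ht.1 htθ hθ.2
    fun r hr ↦ (quantile_mono hr.2.le).trans_lt hq).ne htg

lemma IsAdmissible.theta2_g (hν : IsAdmissible ν) {θ : ℝ} (hθ : θ ∈ Set.Icc (0 : ℝ) 1)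
    (hq : 1 < quantile ν θ) : theta2 ν (g ν θ) = θ := by
  refine IsGreatest.csSup_eq ⟨⟨hθ, rfl⟩, fun t ⟨ht, htg⟩ ↦ ?_⟩
  by_contra! htθ
  exact (hν.g_gt_of_one_lt_quantile hθ.1 htθ ht.2
    fun r hr ↦ hq.trans_le (quantile_mono hr.1.le)).ne htg

/-! ### The level sets of `g` -/

lemma IsAdmissible.g_one_le_gMax (hν : IsAdmissible ν) : g ν 1 ≤ gMax ν :=
  hν.g_le_gMax (Set.right_mem_Icc.2 zero_le_one)

lemma IsAdmissible.isCompact_level (hν : IsAdmissible ν) (c : ℝ) :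
    IsCompact {θ ∈ Set.Icc (0 : ℝ) 1 | g ν θ = c} :=
  isCompact_Icc.of_isClosed_subset
    (hν.continuousOn_g.preimage_isClosed_of_isClosed isClosed_Icc isClosed_singleton)
    fun _ h ↦ h.1

lemma IsAdmissible.exists_level_le (hν : IsAdmissible ν) {c θ : ℝ} (hc : g ν 1 ≤ c)
    (hθ : θ ∈ Set.Icc (0 : ℝ) 1) (hcθ : c ≤ g ν θ) :
    ∃ t ∈ {t ∈ Set.Icc (0 : ℝ) 1 | g ν t = c}, t ≤ θ := by
  obtain ⟨t, ht, rfl⟩ := intermediate_value_Icc hθ.1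
    (hν.continuousOn_g.mono (Set.Icc_subset_Icc_right hθ.2))
    ⟨by rw [g_zero]; exact hν.g_one_nonneg.trans hc, hcθ⟩
  exact ⟨t, ⟨⟨ht.1, ht.2.trans hθ.2⟩, rfl⟩, ht.2⟩

lemma IsAdmissible.exists_level_ge (hν : IsAdmissible ν) {c θ : ℝ} (hc : g ν 1 ≤ c)
    (hθ : θ ∈ Set.Icc (0 : ℝ) 1) (hcθ : c ≤ g ν θ) :
    ∃ t ∈ {t ∈ Set.Icc (0 : ℝ) 1 | g ν t = c}, θ ≤ t := by
  obtain ⟨t, ht, rfl⟩ := intermediate_value_Icc' hθ.2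
    (hν.continuousOn_g.mono (Set.Icc_subset_Icc_left hθ.1)) ⟨hc, hcθ⟩
  exact ⟨t, ⟨⟨hθ.1.trans ht.1, ht.2⟩, rfl⟩, ht.1⟩

lemma IsAdmissible.level_nonempty (hν : IsAdmissible ν) {c : ℝ} (hc : c ∈ Set.Icc (g ν 1) (gMax ν)) :
    {θ ∈ Set.Icc (0 : ℝ) 1 | g ν θ = c}.Nonempty := by
  obtain ⟨m, hm, hmg, -⟩ := hν.exists_isMax
  obtain ⟨t, ht, -⟩ := hν.exists_level_le hc.1 hm (hc.2.trans hmg.ge)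
  exact ⟨t, ht⟩

lemma IsAdmissible.theta1_mem (hν : IsAdmissible ν) {c : ℝ} (hc : c ∈ Set.Icc (g ν 1) (gMax ν)) :
    theta1 ν c ∈ Set.Icc (0 : ℝ) 1 ∧ g ν (theta1 ν c) = c :=
  (hν.isCompact_level c).sInf_mem (hν.level_nonempty hc)

lemma IsAdmissible.theta2_mem (hν : IsAdmissible ν) {c : ℝ} (hc : c ∈ Set.Icc (g ν 1) (gMax ν)) :
    theta2 ν c ∈ Set.Icc (0 : ℝ) 1 ∧ g ν (theta2 ν c) = c :=
  (hν.isCompact_level c).sSup_mem (hν.level_nonempty hc)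

/-- Unimodality of `g`: above a level `c ≥ g(1)` it describes an interval. -/
lemma IsAdmissible.superlevel_eq (hν : IsAdmissible ν) {c : ℝ}
    (hc : c ∈ Set.Icc (g ν 1) (gMax ν)) :
    {θ ∈ Set.Icc (0 : ℝ) 1 | c ≤ g ν θ} = Set.Icc (theta1 ν c) (theta2 ν c) := by
  obtain ⟨h1, hg1⟩ := hν.theta1_mem hc
  obtain ⟨h2, hg2⟩ := hν.theta2_mem hc
  ext θ
  constructor
  · rintro ⟨hθ, hcθ⟩
    obtain ⟨t, ht, htθ⟩ := hν.exists_level_le hc.1 hθ hcθ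
    obtain ⟨s, hs, hθs⟩ := hν.exists_level_ge hc.1 hθ hcθ
    exact ⟨(csInf_le (hν.isCompact_level c).bddBelow ht).trans htθ,
      hθs.trans (le_csSup (hν.isCompact_level c).bddAbove hs)⟩
  · rintro ⟨h1θ, hθ2⟩
    refine ⟨⟨h1.1.trans h1θ, hθ2.trans h2.2⟩, ?_⟩
    rcases lt_or_ge (quantile ν θ) 1 with hq | hq
    · exact hg1.ge.trans (hν.g_le_of_quantile_le_one h1.1 h1θ (hθ2.trans h2.2)
        fun r hr ↦ (quantile_mono hr.2.le).trans hq.le)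
    · exact hg2.ge.trans (hν.g_ge_of_one_le_quantile (h1.1.trans h1θ) hθ2 h2.2
        fun r hr ↦ hq.trans (quantile_mono hr.1.le))

lemma IsAdmissible.theta1_le_theta2 (hν : IsAdmissible ν) {c : ℝ}
    (hc : c ∈ Set.Icc (g ν 1) (gMax ν)) : theta1 ν c ≤ theta2 ν c :=
  csInf_le_csSup (hν.level_nonempty hc) (hν.isCompact_level c).bddBelow
    (hν.isCompact_level c).bddAbove

lemma IsAdmissible.theta_anti (hν : IsAdmissible ν) {c d : ℝ}
    (hc : c ∈ Set.Icc (g ν 1) (gMax ν)) (hd : d ∈ Set.Icc (g ν 1) (gMax ν)) (hcd : c ≤ d) :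
    theta1 ν c ≤ theta1 ν d ∧ theta2 ν d ≤ theta2 ν c := by
  rw [← Set.Icc_subset_Icc_iff (hν.theta1_le_theta2 hd), ← hν.superlevel_eq hc,
    ← hν.superlevel_eq hd]
  exact fun θ hθ ↦ ⟨hθ.1, hcd.trans hθ.2⟩

lemma IsAdmissible.quantile_theta1_lt_one (hν : IsAdmissible ν) {c : ℝ}
    (hc : c ∈ Set.Ico (g ν 1) (gMax ν)) : quantile ν (theta1 ν c) < 1 := by
  have hc' := Set.Ico_subset_Icc_self hc
  obtain ⟨m, hm, hmg, -⟩ := hν.exists_isMax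
  have hmem : m ∈ Set.Icc (theta1 ν c) (theta2 ν c) := by
    rw [← hν.superlevel_eq hc']
    exact ⟨hm, hc'.2.trans hmg.ge⟩
  obtain ⟨h1, hg1⟩ := hν.theta1_mem hc'
  by_contra! hq
  have := hν.g_ge_of_one_le_quantile h1.1 hmem.1 hm.2
      fun r hr ↦ hq.trans (quantile_mono hr.1.le)
  linarith [hc.2]

lemma IsAdmissible.one_lt_quantile_theta2 (hν : IsAdmissible ν) {c : ℝ}
    (hc : c ∈ Set.Ico (g ν 1) (gMax ν)) : 1 < quantile ν (theta2 ν c) := by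
  have hc' := Set.Ico_subset_Icc_self hc
  obtain ⟨m, hm, hmg, -⟩ := hν.exists_isMax
  have hmem : m ∈ Set.Icc (theta1 ν c) (theta2 ν c) := by
    rw [← hν.superlevel_eq hc']
    exact ⟨hm, hc'.2.trans hmg.ge⟩
  obtain ⟨h2, hg2⟩ := hν.theta2_mem hc'
  by_contra! hq
  have := hν.g_le_of_quantile_le_one hm.1 hmem.2 h2.2
      fun r hr ↦ (quantile_mono hr.2.le).trans hq
  linarith [hc.2]

lemma IsAdmissible.quantile_theta2_lt_top (hν : IsAdmissible ν) {c : ℝ}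
    (hc : c ∈ Set.Ioc (g ν 1) (gMax ν)) : quantile ν (theta2 ν c) < ∞ := by
  obtain ⟨h2, hg2⟩ := hν.theta2_mem (Set.Ioc_subset_Icc_self hc)
  refine quantile_lt_top (h2.2.lt_of_ne fun h ↦ ?_)
  rw [h] at hg2
  exact hc.1.ne hg2

/-! ### Measurability of the levels -/

/-- The level `c` projected onto `[g(1), g*]`. -/
def clampLevel (ν : Measure ℝ) (c : ℝ) : ℝ := max (g ν 1) (min c (gMax ν))

/-- `F⁻¹(θ₁(c))` for `c ∈ [g(1), g*]`, extended by constants to all of `ℝ`. -/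
def lowerLevel (ν : Measure ℝ) (c : ℝ) : ℝ≥0∞ := quantile ν (theta1 ν (clampLevel ν c))

/-- `F⁻¹(θ₂(c))` for `c ∈ [g(1), g*]`, extended by constants to all of `ℝ`. -/
def upperLevel (ν : Measure ℝ) (c : ℝ) : ℝ≥0∞ := quantile ν (theta2 ν (clampLevel ν c))

lemma IsAdmissible.clampLevel_mem (hν : IsAdmissible ν) (c : ℝ) :
    clampLevel ν c ∈ Set.Icc (g ν 1) (gMax ν) :=
  ⟨le_max_left _ _, max_le hν.g_one_le_gMax (min_le_right _ _)⟩

lemma clampLevel_of_mem {c : ℝ} (h1 : g ν 1 ≤ c) (h2 : c ≤ gMax ν) :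
    clampLevel ν c = c := by
  rw [clampLevel, min_eq_left h2, max_eq_right h1]

lemma clampLevel_mono : Monotone (clampLevel ν) := fun _ _ hcd ↦
  max_le_max le_rfl (min_le_min hcd le_rfl)

lemma IsAdmissible.measurable_lowerLevel (hν : IsAdmissible ν) : Measurable (lowerLevel ν) :=
  Monotone.measurable fun c d hcd ↦ quantile_mono
    (hν.theta_anti (hν.clampLevel_mem c) (hν.clampLevel_mem d) (clampLevel_mono hcd)).1

lemma IsAdmissible.measurable_upperLevel (hν : IsAdmissible ν) : Measurable (upperLevel ν) :=
  Antitone.measurable fun c d hcd ↦ quantile_mono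
    (hν.theta_anti (hν.clampLevel_mem c) (hν.clampLevel_mem d) (clampLevel_mono hcd)).2

lemma U_eq (θ : ℝ) : U ν θ = if g ν θ < g ν 1 then quantile ν θ
    else if g ν θ < gMax ν then lowerLevel ν (g ν θ) else 1 := by
  rw [U]
  split_ifs with h1 h2
  · rfl
  · rw [lowerLevel, clampLevel_of_mem (not_lt.1 h1) h2.le]
  · rfl

lemma V_eq (θ : ℝ) : V ν θ = if g ν θ < g ν 1 then ∞
    else if g ν θ < gMax ν then upperLevel ν (g ν θ) else 1 := by
  rw [V]
  split_ifs with h1 h2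
  · rfl
  · rw [upperLevel, clampLevel_of_mem (not_lt.1 h1) h2.le]
  · rfl

lemma IsAdmissible.measurable_U (hν : IsAdmissible ν) : Measurable (U ν) := by
  simp_rw [funext U_eq]
  exact Measurable.ite (measurableSet_lt measurable_g measurable_const) measurable_quantile
    (Measurable.ite (measurableSet_lt measurable_g measurable_const)
      (hν.measurable_lowerLevel.comp measurable_g) measurable_const)

lemma IsAdmissible.measurable_V (hν : IsAdmissible ν) : Measurable (V ν) := by
  simp_rw [funext V_eq]
  exact Measurable.ite (measurableSet_lt measurable_g measurable_const) measurable_const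
    (Measurable.ite (measurableSet_lt measurable_g measurable_const)
      (hν.measurable_upperLevel.comp measurable_g) measurable_const)

/-! ### The balance identity and the mixture over the levels -/

/-- On `{g ≥ c}`, `c ≥ g(1)`, the positive and the negative part of `g' = 1 - F⁻¹` have the same
integral: `g` takes the same value at the two endpoints of this interval. -/
lemma IsAdmissible.setLIntegral_superlevel (hν : IsAdmissible ν) {c : ℝ} (hc : g ν 1 ≤ c) :
    ∫⁻ θ in Set.Ioo 0 1 ∩ {θ | c ≤ g ν θ}, (1 - quantile ν θ) =
      ∫⁻ θ in Set.Ioo 0 1 ∩ {θ | c ≤ g ν θ}, (quantile ν θ - 1) := by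
  rcases lt_or_ge (gMax ν) c with hcM | hcM
  · have : Set.Ioo 0 1 ∩ {θ | c ≤ g ν θ} = ∅ := by
      ext θ
      simp only [Set.mem_inter_iff, Set.mem_ofPred_eq, Set.mem_empty_iff_false, iff_false, not_and,
        not_le]
      exact fun hθ ↦ (hν.g_le_gMax (Set.Ioo_subset_Icc_self hθ)).trans_lt hcM
    simp [this]
  obtain ⟨h1, hg1⟩ := hν.theta1_mem ⟨hc, hcM⟩
  obtain ⟨h2, hg2⟩ := hν.theta2_mem ⟨hc, hcM⟩
  have h12 := hν.theta1_le_theta2 ⟨hc, hcM⟩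
  have hae : (Set.Ioo 0 1 ∩ {θ | c ≤ g ν θ} : Set ℝ) =ᵐ[volume]
      Set.Ioo (theta1 ν c) (theta2 ν c) := by
    refine (Ioo_ae_eq_Icc.inter (ae_eq_refl _)).trans ?_
    have : Set.Icc 0 1 ∩ {θ | c ≤ g ν θ} = Set.Icc (theta1 ν c) (theta2 ν c) :=
      hν.superlevel_eq ⟨hc, hcM⟩
    rw [this]
    exact Ioo_ae_eq_Icc.symm
  rw [setLIntegral_congr hae, setLIntegral_congr hae]
  set s := Set.Ioo (theta1 ν c) (theta2 ν c)
  have hq : ∫⁻ θ in s, quantile ν θ = ∫⁻ θ in s, 1 := by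
    have hsub := hν.g_sub h1.1 h12 h2.2
    rw [hg1, hg2, sub_self, eq_comm, sub_eq_zero] at hsub
    rw [setLIntegral_one, Real.volume_Ioo, hsub,
      ENNReal.ofReal_toReal (hν.lintegral_quantile_ne_top h1.1 h12 h2.2)]
  have hadd : (∫⁻ θ in s, (1 - quantile ν θ)) + ∫⁻ θ in s, quantile ν θ =
      (∫⁻ θ in s, (quantile ν θ - 1)) + ∫⁻ θ in s, 1 := by
    rw [← lintegral_add_right (fun θ ↦ 1 - quantile ν θ) measurable_quantile,
      ← lintegral_add_right (fun θ ↦ quantile ν θ - 1) measurable_const]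
    refine lintegral_congr fun θ ↦ ?_
    rw [tsub_add_eq_max, tsub_add_eq_max, max_comm]
  rw [hq] at hadd
  have hfin : ∫⁻ θ in s, 1 ≠ ∞ := by simp [s]
  exact (ENNReal.add_left_inj hfin).1 hadd

/-- The substitution `c = g(θ)` on the increasing and on the decreasing branch of `g` gives the
same measure `dc` on `[g(1), g*]`. -/
lemma IsAdmissible.setLIntegral_comp_g (hν : IsAdmissible ν) {φ : ℝ → ℝ≥0∞} (hφ : Measurable φ) :
    ∫⁻ θ in Set.Ioo 0 1 ∩ {θ | g ν 1 ≤ g ν θ}, (1 - quantile ν θ) * φ (g ν θ) =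
      ∫⁻ θ in Set.Ioo 0 1 ∩ {θ | g ν 1 ≤ g ν θ}, (quantile ν θ - 1) * φ (g ν θ) := by
  set W := Set.Ioo 0 1 ∩ {θ | g ν 1 ≤ g ν θ} with hW
  have hd₁ : Measurable fun θ ↦ 1 - quantile ν θ := measurable_const.sub measurable_quantile
  have hd₂ : Measurable fun θ ↦ quantile ν θ - 1 := measurable_quantile.sub measurable_const
  have key : ((volume.restrict W).withDensity fun θ ↦ 1 - quantile ν θ).map (g ν) =
      ((volume.restrict W).withDensity fun θ ↦ quantile ν θ - 1).map (g ν) := by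
    have hfin : ∫⁻ θ in W, (1 - quantile ν θ) ≠ ∞ := by
      refine ne_top_of_le_ne_top (b := 1) ENNReal.one_ne_top ?_
      calc ∫⁻ θ in W, (1 - quantile ν θ) ≤ ∫⁻ θ in Set.Ioo (0 : ℝ) 1, 1 :=
            (lintegral_mono_set Set.inter_subset_left).trans (lintegral_mono fun θ ↦ tsub_le_self)
        _ = 1 := by simp
    have : IsFiniteMeasure ((volume.restrict W).withDensity fun θ ↦ 1 - quantile ν θ) :=
      isFiniteMeasure_withDensity hfin
    refine Measure.ext_of_Ici _ _ fun c ↦ ?_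
    have hm : MeasurableSet (g ν ⁻¹' Set.Ici c) := measurable_g measurableSet_Ici
    rw [Measure.map_apply measurable_g measurableSet_Ici,
      Measure.map_apply measurable_g measurableSet_Ici, withDensity_apply _ hm,
      withDensity_apply _ hm, Measure.restrict_restrict hm]
    have : g ν ⁻¹' Set.Ici c ∩ W = Set.Ioo 0 1 ∩ {θ | max c (g ν 1) ≤ g ν θ} := by
      ext θ
      simp only [hW, Set.mem_inter_iff, Set.mem_preimage, Set.mem_Ici, Set.mem_ofPred_eq, max_le_iff]
      tauto
    rw [this]
    exact hν.setLIntegral_superlevel (le_max_right _ _)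
  have hφg : Measurable fun θ ↦ φ (g ν θ) := hφ.comp measurable_g
  have := congrArg (fun μ ↦ ∫⁻ c, φ c ∂μ) key
  rwa [lintegral_map hφ measurable_g, lintegral_map hφ measurable_g,
    lintegral_withDensity_eq_lintegral_mul _ hd₁ hφg,
    lintegral_withDensity_eq_lintegral_mul _ hd₂ hφg] at this

/-- The law of `Y` at the exit from `(a, b)`, integrated against `f`: all mass sits at `1` for
`a = 1`, at `a` for `b = ∞`, and for `a < 1 < b < ∞` the weights make the mean equal to `1`. -/
def exitMean (f : ℝ → ℝ≥0∞) (a b : ℝ≥0∞) : ℝ≥0∞ :=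
  if a = 1 then f 1 else if b = ∞ then f a.toReal
  else (b - 1) / (b - a) * f a.toReal + (1 - a) / (b - a) * f b.toReal

/-- The interval `(a, b)` is either empty with `a = b = 1` or a neighbourhood of the starting point
`1`, the two situations in which `exitMean` describes the exit law. -/
def LevelsOK (a b : ℝ≥0∞) : Prop := (a = 1 ∧ b = 1) ∨ (a < 1 ∧ 1 < b)

/-- For almost every `θ`, the levels `U(θ)`, `V(θ)` fall into one of three types. -/
lemma IsAdmissible.ae_cases (hν : IsAdmissible ν) : ∀ᵐ θ ∂(volume.restrict (Set.Ioo (0 : ℝ) 1)),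
    (g ν θ < g ν 1 ∧ U ν θ = quantile ν θ ∧ V ν θ = ∞ ∧ quantile ν θ < 1) ∨
    (g ν θ = gMax ν ∧ g ν 1 ≤ g ν θ ∧ U ν θ = 1 ∧ V ν θ = 1 ∧ quantile ν θ = 1) ∨
    (g ν 1 < g ν θ ∧ g ν θ < gMax ν ∧
      U ν θ = lowerLevel ν (g ν θ) ∧ V ν θ = upperLevel ν (g ν θ) ∧
      U ν θ < 1 ∧ 1 < V ν θ ∧ V ν θ < ∞ ∧
      ((quantile ν θ < 1 ∧ quantile ν θ = U ν θ) ∨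
        (1 < quantile ν θ ∧ quantile ν θ = V ν θ))) := by
  -- Where `F⁻¹ ≠ 1`, `g` takes each value at most once on either side of its maximum.
  have hsub₁ : ∀ c, {θ ∈ Set.Ioo (0 : ℝ) 1 | quantile ν θ < 1 ∧ g ν θ = c}.Subsingleton := by
    rintro c s ⟨hs, hqs, rfl⟩ t ⟨ht, hqt, htg⟩
    rw [← hν.theta1_g (Set.Ioo_subset_Icc_self hs) hqs, ← htg,
      hν.theta1_g (Set.Ioo_subset_Icc_self ht) hqt]
  have hsub₂ : ∀ c, {θ ∈ Set.Ioo (0 : ℝ) 1 | 1 < quantile ν θ ∧ g ν θ = c}.Subsingleton := by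
    rintro c s ⟨hs, hqs, rfl⟩ t ⟨ht, hqt, htg⟩
    rw [← hν.theta2_g (Set.Ioo_subset_Icc_self hs) hqs, ← htg,
      hν.theta2_g (Set.Ioo_subset_Icc_self ht) hqt]
  have hnull (s : Set ℝ) (hs : s.Subsingleton) :
      ∀ᵐ θ ∂(volume.restrict (Set.Ioo (0 : ℝ) 1)), θ ∉ s :=
    measure_eq_zero_iff_ae_notMem.1 (hs.measure_zero _)
  filter_upwards [ae_restrict_mem measurableSet_Ioo, hnull _ (hsub₁ (g ν 1)),
    hnull _ (hsub₂ (g ν 1)), hnull _ (hsub₂ (gMax ν))] with θ hθ hn1 hn2 hn3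
  have hθ' := Set.Ioo_subset_Icc_self hθ
  simp only [hθ, true_and, not_and] at hn1 hn2 hn3
  rcases lt_or_ge (g ν θ) (g ν 1) with h1 | h1
  · exact Or.inl ⟨h1, by simp [U, h1], by simp [V, h1], hν.quantile_lt_one_of_g_lt hθ' h1⟩
  rcases (hν.g_le_gMax hθ').eq_or_lt with h2 | h2
  · refine Or.inr (Or.inl ⟨h2, h1, ?_, ?_, le_antisymm ?_ ?_⟩)
    · rw [U, if_neg h1.not_gt, if_neg h2.not_lt]
    · rw [V, if_neg h1.not_gt, if_neg h2.not_lt]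
    · exact not_lt.1 fun hq ↦ hn3 hq h2
    · exact not_lt.1 fun hq ↦ (hν.g_lt_gMax hθ'.1 hq).ne h2
  · refine Or.inr (Or.inr ?_)
    have hU : U ν θ = quantile ν (theta1 ν (g ν θ)) := by simp [U, h1.not_gt, h2]
    have hV : V ν θ = quantile ν (theta2 ν (g ν θ)) := by simp [V, h1.not_gt, h2]
    have hU' : U ν θ = lowerLevel ν (g ν θ) := by simp [U_eq, h1.not_gt, h2]
    have hV' : V ν θ = upperLevel ν (g ν θ) := by simp [V_eq, h1.not_gt, h2]
    have hU1 : U ν θ < 1 := hU ▸ hν.quantile_theta1_lt_one ⟨h1, h2⟩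
    have hV1 : 1 < V ν θ := hV ▸ hν.one_lt_quantile_theta2 ⟨h1, h2⟩
    have hcase : (quantile ν θ < 1 ∧ quantile ν θ = U ν θ) ∨
        (1 < quantile ν θ ∧ quantile ν θ = V ν θ) := by
      rcases lt_or_ge (quantile ν θ) 1 with hq | hq
      · exact Or.inl ⟨hq, by rw [hU, hν.theta1_g hθ' hq]⟩
      · have hq' := hν.one_lt_quantile hθ' h2 hq
        exact Or.inr ⟨hq', by rw [hV, hν.theta2_g hθ' hq']⟩
    have h1' : g ν 1 < g ν θ := by
      refine h1.lt_of_ne fun he ↦ ?_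
      rcases hcase with hq | hq
      · exact hn1 hq.1 he.symm
      · exact hn2 hq.1 he.symm
    exact ⟨h1', h2, hU', hV', hU1, hV1,
      hV ▸ hν.quantile_theta2_lt_top ⟨h1', h2.le⟩, hcase⟩

lemma IsAdmissible.ae_levelsOK (hν : IsAdmissible ν) :
    ∀ᵐ θ ∂(volume.restrict (Set.Ioo (0 : ℝ) 1)), LevelsOK (U ν θ) (V ν θ) := by
  filter_upwards [hν.ae_cases] with θ hθ
  rcases hθ with ⟨-, hU, hV, hq⟩ | ⟨-, -, hU, hV, -⟩ | ⟨-, -, -, -, hU, hV, -⟩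
  · exact Or.inr ⟨hU ▸ hq, hV ▸ ENNReal.one_lt_top⟩
  · exact Or.inl ⟨hU, hV⟩
  · exact Or.inr ⟨hU, hV⟩

lemma div_add_div_eq_one {a b : ℝ≥0∞} (ha : a < 1) (hb : 1 < b) (hb' : b < ∞) :
    (b - 1) / (b - a) + (1 - a) / (b - a) = 1 := by
  rw [ENNReal.div_add_div_same, tsub_add_tsub_cancel hb.le ha.le]
  exact ENNReal.div_self (tsub_pos_of_lt (ha.trans hb)).ne' (by finiteness)

/-- The mixture over `θ` of the exit laws from `(U(θ), V(θ))` is `ν`. -/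
lemma IsAdmissible.lintegral_exitMean (hν : IsAdmissible ν) {f : ℝ → ℝ≥0∞} (hf : Measurable f)
    (hf1 : ∀ x, f x ≤ 1) :
    ∫⁻ θ in Set.Ioo 0 1, exitMean f (U ν θ) (V ν θ) = ∫⁻ x, f x ∂ν := by
  have := hν.isProbabilityMeasure
  rw [← lintegral_comp_toReal_quantile hν.nonneg hf]
  -- `φ l` is `f(l) / (b - a)` on `(g(1), g*)`, used for `l = a` and `l = b`.
  let J := Set.Ioo (g ν 1) (gMax ν)
  let φ : (ℝ → ℝ≥0∞) → ℝ → ℝ≥0∞ := fun l ↦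
    J.indicator fun c ↦ f (l c).toReal / (upperLevel ν c - lowerLevel ν c)
  have hφ {l : ℝ → ℝ≥0∞} (hl : Measurable l) : Measurable (φ l) :=
    ((hf.comp hl.ennreal_toReal).div
      (hν.measurable_upperLevel.sub hν.measurable_lowerLevel)).indicator measurableSet_Ioo
  have hswap {l : ℝ → ℝ≥0∞} (hl : Measurable l) :
      ∫⁻ θ in Set.Ioo 0 1, (1 - quantile ν θ) * φ l (g ν θ) =
        ∫⁻ θ in Set.Ioo 0 1, (quantile ν θ - 1) * φ l (g ν θ) := by
    have hm : MeasurableSet {θ | g ν 1 ≤ g ν θ} := measurable_g measurableSet_Ici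
    have hsupp (ψ : ℝ → ℝ≥0∞) : ∫⁻ θ in Set.Ioo 0 1, ψ θ * φ l (g ν θ) =
        ∫⁻ θ in Set.Ioo 0 1 ∩ {θ | g ν 1 ≤ g ν θ}, ψ θ * φ l (g ν θ) := by
      rw [Set.inter_comm, ← Measure.restrict_restrict hm, ← lintegral_indicator hm]
      refine lintegral_congr fun θ ↦ ?_
      rw [eq_comm, Set.indicator_apply_eq_self]
      intro hθ
      have : g ν θ ∉ J := fun hJ ↦ hθ hJ.1.le
      simp [φ, this]
    rw [hsupp, hsupp, hν.setLIntegral_comp_g (hφ hl)]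
  have hgφ {l : ℝ → ℝ≥0∞} (hl : Measurable l) : Measurable fun θ ↦ φ l (g ν θ) :=
    (hφ hl).comp measurable_g
  have hd₁ : Measurable fun θ ↦ 1 - quantile ν θ := measurable_const.sub measurable_quantile
  have hd₂ : Measurable fun θ ↦ quantile ν θ - 1 := measurable_quantile.sub measurable_const
  have hL := hν.measurable_lowerLevel
  have hR := hν.measurable_upperLevel
  -- The difference of the integrands is `(1 - F⁻¹) (f(b) - f(a)) / (b - a)`, written without
  -- subtraction: at most one of the truncated terms `1 - F⁻¹` and `F⁻¹ - 1` is nonzero.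
  have hpt : ∀ᵐ θ ∂(volume.restrict (Set.Ioo (0 : ℝ) 1)),
      exitMean f (U ν θ) (V ν θ) + ((1 - quantile ν θ) * φ (lowerLevel ν) (g ν θ) +
        (quantile ν θ - 1) * φ (upperLevel ν) (g ν θ)) =
      f (quantile ν θ).toReal + ((1 - quantile ν θ) * φ (upperLevel ν) (g ν θ) +
        (quantile ν θ - 1) * φ (lowerLevel ν) (g ν θ)) := by
    filter_upwards [hν.ae_cases] with θ hθ
    rcases hθ with ⟨h1, hU, hV, hq⟩ | ⟨h2, -, hU, hV, hq⟩ | ⟨h1, h2, hU, hV, hU1, hV1, hVt, hq⟩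
    · have : g ν θ ∉ J := fun hJ ↦ h1.not_gt hJ.1
      simp [φ, this, exitMean, hU, hV, hq.ne]
    · have : g ν θ ∉ J := fun hJ ↦ h2.not_lt hJ.2
      simp [φ, this, exitMean, hU, hq]
    · have hJ : g ν θ ∈ J := ⟨h1, h2⟩
      have h1w := div_add_div_eq_one hU1 hV1 hVt
      simp only [exitMean, hU1.ne, hVt.ne, if_false, φ, Set.indicator_of_mem hJ, ← hU, ← hV]
      rcases hq with ⟨hq, hqU⟩ | ⟨hq, hqV⟩
      · rw [tsub_eq_zero_of_le hq.le, hqU]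
        calc _ = ((V ν θ - 1) / (V ν θ - U ν θ) + (1 - U ν θ) / (V ν θ - U ν θ)) * f (U ν θ).toReal +
              (1 - U ν θ) / (V ν θ - U ν θ) * f (V ν θ).toReal := by
              simp only [div_eq_mul_inv]
              ring
          _ = _ := by
              rw [h1w]
              simp only [div_eq_mul_inv]
              ring
      · rw [tsub_eq_zero_of_le hq.le, hqV]
        calc _ = ((V ν θ - 1) / (V ν θ - U ν θ) + (1 - U ν θ) / (V ν θ - U ν θ)) * f (V ν θ).toReal +
              (V ν θ - 1) / (V ν θ - U ν θ) * f (U ν θ).toReal := by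
              simp only [div_eq_mul_inv]
              ring
          _ = _ := by
              rw [h1w]
              simp only [div_eq_mul_inv]
              ring
  -- The correction terms are finite, hence can be cancelled: `b - a` dominates `|1 - F⁻¹|`.
  have hbound : ∀ᵐ θ ∂(volume.restrict (Set.Ioo (0 : ℝ) 1)),
      (1 - quantile ν θ) * φ (upperLevel ν) (g ν θ) + (quantile ν θ - 1) * φ (lowerLevel ν) (g ν θ)
        ≤ 1 := by
    filter_upwards [hν.ae_cases] with θ hθ
    rcases hθ with ⟨h1, -⟩ | ⟨h2, -⟩ | ⟨h1, h2, hU, hV, hU1, hV1, hVt, hq⟩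
    · have : g ν θ ∉ J := fun hJ ↦ h1.not_gt hJ.1
      simp [φ, this]
    · have : g ν θ ∉ J := fun hJ ↦ h2.not_lt hJ.2
      simp [φ, this]
    · have hJ : g ν θ ∈ J := ⟨h1, h2⟩
      have h1w := div_add_div_eq_one hU1 hV1 hVt
      simp only [φ, Set.indicator_of_mem hJ, ← hU, ← hV]
      refine le_of_le_of_eq ?_ h1w
      rcases hq with ⟨hq, hqU⟩ | ⟨hq, hqV⟩
      · rw [tsub_eq_zero_of_le hq.le, hqU, zero_mul, add_zero, ← mul_div_assoc]
        refine le_add_left ?_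
        gcongr
        exact mul_le_of_le_one_right' (hf1 _)
      · rw [tsub_eq_zero_of_le hq.le, hqV, zero_mul, zero_add, ← mul_div_assoc]
        refine le_add_right ?_
        gcongr
        exact mul_le_of_le_one_right' (hf1 _)
  have hint := lintegral_congr_ae hpt
  have hm₁ : Measurable fun θ ↦ (1 - quantile ν θ) * φ (lowerLevel ν) (g ν θ) +
      (quantile ν θ - 1) * φ (upperLevel ν) (g ν θ) :=
    (hd₁.mul (hgφ hL)).add (hd₂.mul (hgφ hR))
  have hm₂ : Measurable fun θ ↦ (1 - quantile ν θ) * φ (upperLevel ν) (g ν θ) +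
      (quantile ν θ - 1) * φ (lowerLevel ν) (g ν θ) :=
    (hd₁.mul (hgφ hR)).add (hd₂.mul (hgφ hL))
  rw [lintegral_add_right _ hm₁, lintegral_add_right _ hm₂] at hint
  have heq : ∫⁻ θ in Set.Ioo 0 1, ((1 - quantile ν θ) * φ (lowerLevel ν) (g ν θ) +
        (quantile ν θ - 1) * φ (upperLevel ν) (g ν θ)) =
      ∫⁻ θ in Set.Ioo 0 1, ((1 - quantile ν θ) * φ (upperLevel ν) (g ν θ) +
        (quantile ν θ - 1) * φ (lowerLevel ν) (g ν θ)) := by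
    have hmR : Measurable fun θ ↦ (quantile ν θ - 1) * φ (upperLevel ν) (g ν θ) := hd₂.mul (hgφ hR)
    have hmL : Measurable fun θ ↦ (quantile ν θ - 1) * φ (lowerLevel ν) (g ν θ) := hd₂.mul (hgφ hL)
    rw [lintegral_add_right _ hmR, lintegral_add_right _ hmL, hswap hL, hswap hR, add_comm]
  rw [heq] at hint
  refine (ENNReal.add_left_inj ?_).1 hint
  refine ne_top_of_le_ne_top (b := 1) ENNReal.one_ne_top ?_
  calc _ ≤ ∫⁻ θ in Set.Ioo (0 : ℝ) 1, 1 := lintegral_mono_ae hbound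
    _ = 1 := by simp

/-! ### First exit times of continuous paths -/

/-- The first exit time of the path `f` from the open interval `(a, b)`. -/
def firstExit (f : ℝ≥0 → ℝ≥0∞) (a b : ℝ≥0∞) : WithTop ℝ≥0 :=
  ⨅ (t : ℝ≥0) (_ : f t ∉ Set.Ioo a b), (t : WithTop ℝ≥0)

section FirstExit

variable {f : ℝ≥0 → ℝ≥0∞} {a b : ℝ≥0∞} {t : ℝ≥0}

lemma firstExit_le (h : f t ∉ Set.Ioo a b) : firstExit f a b ≤ t := iInf₂_le t h

lemma mem_Ioo_of_lt_firstExit (h : (t : WithTop ℝ≥0) < firstExit f a b) : f t ∈ Set.Ioo a b := by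
  by_contra hf
  exact absurd (firstExit_le hf) (not_le.2 h)

/-- The complement of `(a, b)` is closed, so a finite exit time is attained. -/
lemma firstExit_le_iff (hf : Continuous f) :
    firstExit f a b ≤ t ↔ ∃ s ≤ t, f s ∉ Set.Ioo a b := by
  refine ⟨fun h ↦ ?_, fun ⟨s, hs, hfs⟩ ↦ (firstExit_le hfs).trans (by exact_mod_cast hs)⟩
  set C : Set ℝ≥0 := {s | f s ∉ Set.Ioo a b} with hC
  have hclosed : IsClosed C := (isOpen_Ioo.preimage hf).isClosed_compl
  have hne : C.Nonempty := by
    by_contra hne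
    have : ∀ s, f s ∈ Set.Ioo a b := fun s ↦ by_contra fun hs ↦ hne ⟨s, hs⟩
    have htop : (⊤ : WithTop ℝ≥0) ≤ firstExit f a b := le_iInf₂ fun s hs ↦ absurd (this s) hs
    exact absurd (htop.trans h) (not_le.2 (WithTop.coe_lt_top t))
  have hmem := hclosed.csInf_mem hne (OrderBot.bddBelow C)
  refine ⟨sInf C, ?_, hmem⟩
  have : ((sInf C : ℝ≥0) : WithTop ℝ≥0) ≤ firstExit f a b :=
    le_iInf₂ fun s hs ↦ by exact_mod_cast csInf_le (OrderBot.bddBelow C) hs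
  exact_mod_cast this.trans h

lemma notMem_Ioo_of_firstExit_eq (hf : Continuous f) (h : firstExit f a b = t) :
    f t ∉ Set.Ioo a b := by
  obtain ⟨s, hs, hfs⟩ := (firstExit_le_iff hf).1 h.le
  have hts : t ≤ s := by exact_mod_cast h.symm.le.trans (firstExit_le hfs)
  rwa [hts.antisymm hs]

lemma firstExit_eq_zero (h : f 0 ∉ Set.Ioo a b) : firstExit f a b = 0 :=
  le_antisymm (firstExit_le h) bot_le

/-- A path started inside `(a, b)` leaves the interval through one of its endpoints. -/
lemma eq_or_eq_of_firstExit_eq (hf : Continuous f) (h0 : f 0 ∈ Set.Ioo a b)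
    (h : firstExit f a b = t) : f t = a ∨ f t = b := by
  have hnot := notMem_Ioo_of_firstExit_eq hf h
  have ht : 0 < t := pos_iff_ne_zero.2 fun h ↦ hnot (h ▸ h0)
  have hcl : f t ∈ closure (Set.Ioo a b) := by
    have : (nhdsWithin t (Set.Iio t)).NeBot := nhdsLT_neBot_of_exists_lt ⟨0, ht⟩
    refine mem_closure_of_tendsto (hf.continuousAt.mono_left nhdsWithin_le_nhds :
      Filter.Tendsto f (nhdsWithin t (Set.Iio t)) (nhds (f t))) ?_
    filter_upwards [self_mem_nhdsWithin] with s hs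
    exact mem_Ioo_of_lt_firstExit (h ▸ by exact_mod_cast hs)
  have := closure_minimal Set.Ioo_subset_Icc_self isClosed_Icc hcl
  by_contra! hne
  exact hnot ⟨this.1.lt_of_ne hne.1.symm, this.2.lt_of_ne hne.2⟩

/-- By compactness of `[0, t]`, staying in `(a, b)` on `[0, t]` can be read off from the infimum and
the supremum over a countable dense set of times. -/
lemma lt_firstExit_iff (hf : Continuous f) : (t : WithTop ℝ≥0) < firstExit f a b ↔
    a < ⨅ n, f (t * (TopologicalSpace.denseSeq I n : ℝ).toNNReal) ∧
      ⨆ n, f (t * (TopologicalSpace.denseSeq I n : ℝ).toNNReal) < b := by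
  let e : I → ℝ≥0∞ := fun u ↦ f (t * (u : ℝ).toNNReal)
  have he : Continuous e := by fun_prop
  have h1 : (t : WithTop ℝ≥0) < firstExit f a b ↔ ∀ u, e u ∈ Set.Ioo a b := by
    rw [← not_le, firstExit_le_iff hf]
    push Not
    constructor
    · exact fun h u ↦ h _ (mul_le_of_le_one_right' (by simpa using u.2.2))
    · intro h s hs
      rcases eq_or_ne t 0 with rfl | ht
      · have := h 0
        simpa [e, le_antisymm hs bot_le] using this
      · have hst : (s / t : ℝ) ∈ Set.Icc 0 1 :=
          ⟨by positivity, div_le_one_of_le₀ (by exact_mod_cast hs) (by positivity)⟩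
        have hs' : t * ((⟨s / t, hst⟩ : I) : ℝ).toNNReal = s := by
          have : ((s : ℝ) / t).toNNReal = s / t := by
            rw [← NNReal.coe_div, Real.toNNReal_coe]
          simp only [this]
          exact mul_div_cancel₀ s ht
        have := h ⟨s / t, hst⟩
        simp only [e, hs'] at this
        exact this
  rw [h1]
  change _ ↔ a < ⨅ n, e (TopologicalSpace.denseSeq I n) ∧ ⨆ n, e (TopologicalSpace.denseSeq I n) < b
  have hd := TopologicalSpace.denseRange_denseSeq I
  constructor
  · intro h
    obtain ⟨u, -, hu⟩ := isCompact_univ.exists_isMinOn Set.univ_nonempty he.continuousOn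
    obtain ⟨v, -, hv⟩ := isCompact_univ.exists_isMaxOn Set.univ_nonempty he.continuousOn
    exact ⟨(h u).1.trans_le (le_iInf fun n ↦ hu (Set.mem_univ _)),
      (iSup_le fun n ↦ hv (Set.mem_univ _)).trans_lt (h v).2⟩
  · rintro ⟨ha, hb⟩ u
    refine ⟨ha.trans_le ?_, lt_of_le_of_lt ?_ hb⟩
    · exact hd.induction_on (p := fun u ↦ ⨅ n, e (TopologicalSpace.denseSeq I n) ≤ e u) u
        (isClosed_le continuous_const he) fun n ↦ iInf_le _ n
    · exact hd.induction_on (p := fun u ↦ e u ≤ ⨆ n, e (TopologicalSpace.denseSeq I n)) u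
        (isClosed_le he continuous_const) fun n ↦ le_iSup (fun n ↦ e (TopologicalSpace.denseSeq I n)) n

end FirstExit

section Stochastic

variable {Ω : Type*} {m : MeasurableSpace Ω} {𝓕 : Filtration ℝ≥0 m} {P : Measure Ω}

/-- The exit time of a continuous adapted process from a random interval known at time `0`. -/
lemma isStoppingTime_firstExit {Z : ℝ≥0 → Ω → ℝ≥0∞} (hZ : Adapted 𝓕 Z)
    (hc : ∀ ω, Continuous (Z · ω)) {a b : Ω → ℝ≥0∞} (ha : Measurable[𝓕 0] a)
    (hb : Measurable[𝓕 0] b) :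
    IsStoppingTime 𝓕 fun ω ↦ firstExit (Z · ω) (a ω) (b ω) := by
  intro t
  have ha' : Measurable[𝓕 t] a := ha.mono (𝓕.mono bot_le) le_rfl
  have hb' : Measurable[𝓕 t] b := hb.mono (𝓕.mono bot_le) le_rfl
  have hZ' (n : ℕ) : Measurable[𝓕 t] (Z (t * (TopologicalSpace.denseSeq I n : ℝ).toNNReal)) :=
    (hZ _).mono (𝓕.mono (mul_le_of_le_one_right'
      (by simpa using (TopologicalSpace.denseSeq I n).2.2))) le_rfl
  have : {ω | firstExit (Z · ω) (a ω) (b ω) ≤ t}ᶜ =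
      {ω | a ω < ⨅ n, Z (t * (TopologicalSpace.denseSeq I n : ℝ).toNNReal) ω} ∩
        {ω | ⨆ n, Z (t * (TopologicalSpace.denseSeq I n : ℝ).toNNReal) ω < b ω} := by
    ext ω
    exact not_le.trans (lt_firstExit_iff (hc ω))
  refine MeasurableSet.of_compl (this ▸ MeasurableSet.inter ?_ ?_)
  · exact measurableSet_lt ha' (Measurable.iInf hZ')
  · exact measurableSet_lt (Measurable.iSup hZ') hb'

/-! ### Optional stopping for continuous martingales -/

/-- Approximation of the time `v ≤ t` from the right by times with values in `(n + 1)⁻¹ ℕ ∪ {t}`. -/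
def discretize (n : ℕ) (t v : ℝ≥0) : ℝ≥0 := min ((⌊(n + 1 : ℝ≥0) * v⌋₊ + 1) / (n + 1)) t

lemma le_discretize {n : ℕ} {t v : ℝ≥0} (hv : v ≤ t) : v ≤ discretize n t v := by
  refine le_min ?_ hv
  rw [le_div_iff₀ (by positivity), mul_comm]
  exact (Nat.lt_floor_add_one _).le

lemma discretize_le {n : ℕ} {t v : ℝ≥0} : discretize n t v ≤ v + 1 / (n + 1) := by
  refine (min_le_left _ _).trans ?_
  rw [add_div]
  gcongr
  rw [div_le_iff₀ (by positivity), mul_comm v]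
  exact Nat.floor_le (by positivity)

lemma tendsto_discretize {t v : ℝ≥0} (hv : v ≤ t) :
    Filter.Tendsto (fun n ↦ discretize n t v) Filter.atTop (nhds v) := by
  refine tendsto_of_tendsto_of_tendsto_of_le_of_le tendsto_const_nhds ?_
    (fun n ↦ le_discretize hv) fun n ↦ discretize_le
  simpa using tendsto_const_nhds.add (tendsto_one_div_add_atTop_nhds_zero_nat (𝕜 := ℝ≥0))

lemma discretize_le_iff {n : ℕ} {s t v : ℝ≥0} (hst : s < t) :
    discretize n t v ≤ s ↔ v < ⌊(n + 1 : ℝ≥0) * s⌋₊ / (n + 1) := by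
  rw [discretize, min_le_iff, or_iff_left hst.not_ge, div_le_iff₀ (by positivity),
    lt_div_iff₀ (by positivity), mul_comm s, mul_comm v, ← Nat.floor_lt (by positivity),
    ← Nat.add_one_le_iff, Nat.le_floor_iff (by positivity)]
  push_cast
  rfl

lemma isStoppingTime_discretize {v : Ω → ℝ≥0}
    (hv : IsStoppingTime 𝓕 fun ω ↦ (v ω : WithTop ℝ≥0)) (n : ℕ) (t : ℝ≥0) :
    IsStoppingTime 𝓕 fun ω ↦ (discretize n t (v ω) : WithTop ℝ≥0) := by
  intro s
  rcases le_or_gt t s with hst | hst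
  · have : {ω | (discretize n t (v ω) : WithTop ℝ≥0) ≤ s} = Set.univ := by
      ext ω
      simp only [Set.mem_ofPred_eq, Set.mem_univ, iff_true, WithTop.coe_le_coe]
      exact (min_le_right _ _).trans hst
    rw [this]
    exact MeasurableSet.univ
  · have : {ω | (discretize n t (v ω) : WithTop ℝ≥0) ≤ s} =
        {ω | (v ω : WithTop ℝ≥0) < ((⌊(n + 1 : ℝ≥0) * s⌋₊ / (n + 1) : ℝ≥0) : WithTop ℝ≥0)} := by
      ext ω
      simpa only [Set.mem_ofPred_eq, WithTop.coe_le_coe, WithTop.coe_lt_coe] using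
        discretize_le_iff hst
    rw [this]
    refine 𝓕.mono ?_ _ (hv.measurableSet_lt _)
    rw [div_le_iff₀ (by positivity), mul_comm s]
    exact Nat.floor_le (by positivity)

/-- **Optional stopping** for a continuous martingale at a bounded stopping time. The discretized
stopping times are covered by the countable case, and the stopped values are uniformly integrable
as conditional expectations of `Z t`. -/
lemma integral_stopped_eq [IsProbabilityMeasure P] {Z : ℝ≥0 → Ω → ℝ} (hZ : Martingale Z 𝓕 P)
    (hc : ∀ ω, Continuous (Z · ω)) {v : Ω → ℝ≥0}
    (hv : IsStoppingTime 𝓕 fun ω ↦ (v ω : WithTop ℝ≥0)) {t : ℝ≥0} (hvt : ∀ ω, v ω ≤ t) :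
    ∫ ω, Z (v ω) ω ∂P = ∫ ω, Z t ω ∂P := by
  have hσ (n : ℕ) := isStoppingTime_discretize hv n t
  have hcount (n : ℕ) :
      (Set.range fun ω ↦ (discretize n t (v ω) : WithTop ℝ≥0)).Countable := by
    refine (Set.countable_range fun k : ℕ ↦
      ((min ((k + 1) / (n + 1)) t : ℝ≥0) : WithTop ℝ≥0)).mono ?_
    rintro _ ⟨ω, rfl⟩
    exact ⟨⌊(n + 1 : ℝ≥0) * v ω⌋₊, rfl⟩
  have hce (n : ℕ) : (fun ω ↦ Z (discretize n t (v ω)) ω) =ᵐ[P]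
      P[Z t | (hσ n).measurableSpace] :=
    hZ.stoppedValue_ae_eq_condExp_of_le_const_of_countable_range (hσ n)
      (fun ω ↦ by exact_mod_cast min_le_right _ _) (hcount n)
  have hUI : UniformIntegrable (fun n ω ↦ Z (discretize n t (v ω)) ω) 1 P :=
    ((hZ.integrable t).uniformIntegrable_condExp fun n ↦ (hσ n).measurableSpace_le).ae_eq
      fun n ↦ (hce n).symm
  have hlim : ∀ᵐ ω ∂P, Filter.Tendsto (fun n ↦ Z (discretize n t (v ω)) ω) Filter.atTop
      (nhds (Z (v ω) ω)) := ae_of_all _ fun ω ↦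
    ((hc ω).tendsto (v ω)).comp (tendsto_discretize (hvt ω))
  have hint : Integrable (fun ω ↦ Z (v ω) ω) P := hUI.integrable_of_ae_tendsto hlim
  have hL1 := tendsto_Lp_finite_of_tendsto_ae le_rfl ENNReal.one_ne_top hUI.aestronglyMeasurable
    (memLp_one_iff_integrable.2 hint) hUI.unifIntegrable hlim
  simp only [eLpNorm_one_eq_lintegral_enorm, Pi.sub_apply] at hL1
  have hconv := tendsto_integral_of_L1 _ hint.aestronglyMeasurable
    (Filter.Eventually.of_forall fun n ↦ memLp_one_iff_integrable.1 (hUI.memLp n)) hL1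
  refine tendsto_nhds_unique hconv (tendsto_const_nhds.congr fun n ↦ ?_)
  rw [integral_congr_ae (hce n), integral_condExp]

/-! ### Geometric Brownian motion -/

lemma integrable_exp_mul_increment {X : ℝ≥0 → Ω → ℝ} (hX : IsBrownianReal X P) (s t : ℝ≥0) (c : ℝ) :
    Integrable (fun ω ↦ Real.exp (c * (X t ω - X s ω))) P := by
  have hlaw := hX.toIsPreBrownianReal.hasLaw_sub t s
  have := integrable_exp_mul_gaussianReal (μ := 0) (v := nndist t.1 s.1) c
  rw [← hlaw.map_eq] at this
  exact this.comp_aemeasurable hlaw.aemeasurable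

lemma integral_exp_mul_increment {X : ℝ≥0 → Ω → ℝ} (hX : IsBrownianReal X P) {s t : ℝ≥0}
    (hst : s ≤ t) (c : ℝ) :
    ∫ ω, Real.exp (c * (X t ω - X s ω)) ∂P = Real.exp ((t - s) * c ^ 2 / 2) := by
  have := mgf_gaussianReal (hX.toIsPreBrownianReal.hasLaw_sub t s).map_eq c
  rw [mgf] at this
  simp only [Pi.sub_apply] at this
  have hd : ((nndist t.1 s.1 : ℝ≥0) : ℝ) = t - s := by
    rw [coe_nndist, Real.dist_eq]
    exact abs_of_nonneg (sub_nonneg.2 hst)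
  rw [this, hd, zero_mul, zero_add]

lemma IsBrownianWrt.martingale_exp {X : ℝ≥0 → Ω → ℝ} [IsProbabilityMeasure P]
    (hX : IsBrownianWrt X 𝓕 P) :
    Martingale (fun (t : ℝ≥0) ω ↦ Real.exp (X t ω - (t : ℝ) / 2)) 𝓕 P := by
  have hm (t : ℝ≥0) : Measurable[𝓕 t] fun ω ↦ Real.exp (X t ω - (t : ℝ) / 2) :=
    Real.measurable_exp.comp ((hX.adapted t).sub_const _)
  have h0 := hX.isBrownian.toIsPreBrownianReal.eval_zero_ae_eq_zero
  have hint (t : ℝ≥0) : Integrable (fun ω ↦ Real.exp (X t ω - (t : ℝ) / 2)) P := by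
    refine ((integrable_exp_mul_increment hX.isBrownian 0 t 1).mul_const
      (Real.exp (-(t : ℝ) / 2))).congr ?_
    filter_upwards [h0] with ω hω
    rw [← Real.exp_add, hω]
    ring_nf
  refine ⟨fun t ↦ (hm t).stronglyMeasurable, fun s t hst ↦ ?_⟩
  set W : Ω → ℝ := fun ω ↦ Real.exp (X t ω - X s ω - (t - s) / 2) with hW
  have hWint : Integrable W P := by
    refine ((integrable_exp_mul_increment hX.isBrownian s t 1).mul_const
      (Real.exp (-((t : ℝ) - s) / 2))).congr (ae_of_all _ fun ω ↦ ?_)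
    simp only [hW]
    rw [← Real.exp_add]
    ring_nf
  have hW1 : ∫ ω, W ω ∂P = 1 := by
    have h1 := integral_exp_mul_increment hX.isBrownian hst 1
    have h2 : W = fun ω ↦ Real.exp (1 * (X t ω - X s ω)) * Real.exp (-((t : ℝ) - s) / 2) := by
      ext ω
      simp only [hW]
      rw [← Real.exp_add]
      ring_nf
    rw [h2, integral_mul_const, h1, ← Real.exp_add]
    ring_nf
    exact Real.exp_zero
  have hfac : (fun ω ↦ Real.exp (X t ω - (t : ℝ) / 2)) =
      (fun ω ↦ Real.exp (X s ω - (s : ℝ) / 2)) * W := by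
    ext ω
    simp only [hW, Pi.mul_apply]
    rw [← Real.exp_add]
    ring_nf
  have hXm (u : ℝ≥0) : Measurable (X u) := hX.adapted.measurable
  have hWm : StronglyMeasurable[MeasurableSpace.comap (fun ω ↦ X t ω - X s ω) inferInstance] W :=
    Measurable.stronglyMeasurable (Real.measurable_exp.comp
      ((comap_measurable (fun ω ↦ X t ω - X s ω)).sub_const _))
  have hcond : P[W | 𝓕 s] =ᵐ[P] fun _ ↦ ∫ ω, W ω ∂P :=
    condExp_indep_eq ((hXm t).sub (hXm s)).comap_le (𝓕.le s) hWm (hX.indep s t hst)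
  have hpull := condExp_mul_of_stronglyMeasurable_left (m := 𝓕 s) (μ := P)
    (hm s).stronglyMeasurable (hfac ▸ hint t) hWint
  rw [← hfac] at hpull
  filter_upwards [hpull, hcond] with ω h1 h2
  rw [h1, Pi.mul_apply, h2, hW1, mul_one]

/-- Geometric Brownian motion tends to `0` along the integers: the expectations of its square roots
are `exp (-n / 8)`, which is summable. -/
lemma ae_tendsto_exp_zero {X : ℝ≥0 → Ω → ℝ} (hX : IsBrownianReal X P) :
    ∀ᵐ ω ∂P, Filter.Tendsto (fun n : ℕ ↦ Real.exp (X n ω - (n : ℝ) / 2)) Filter.atTop (nhds 0) := by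
  have h0 := hX.toIsPreBrownianReal.eval_zero_ae_eq_zero
  have hae (n : ℕ) : (fun ω ↦ Real.exp (X n ω / 2 - n / 4)) =ᵐ[P]
      fun ω ↦ Real.exp ((1 / 2) * (X n ω - X 0 ω)) * Real.exp (-(n : ℝ) / 4) := by
    filter_upwards [h0] with ω hω
    rw [← Real.exp_add, hω]
    ring_nf
  have hint (n : ℕ) : Integrable (fun ω ↦ Real.exp (X n ω / 2 - n / 4)) P :=
    ((integrable_exp_mul_increment hX 0 n (1 / 2)).mul_const _).congr (hae n).symm
  have hval (n : ℕ) : ∫ ω, Real.exp (X n ω / 2 - n / 4) ∂P = Real.exp (n * (-1 / 8)) := by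
    rw [integral_congr_ae (hae n), integral_mul_const,
      integral_exp_mul_increment hX zero_le, ← Real.exp_add]
    push_cast
    ring_nf
  have hsum : ∫⁻ ω, ∑' n : ℕ, ENNReal.ofReal (Real.exp (X n ω / 2 - n / 4)) ∂P ≠ ∞ := by
    rw [lintegral_tsum fun n ↦ (hint n).1.aemeasurable.ennreal_ofReal]
    simp_rw [← ofReal_integral_eq_lintegral_ofReal (hint _) (ae_of_all _ fun _ ↦ (Real.exp_pos _).le),
      hval]
    exact (Real.summable_exp_nat_mul_iff.2 (by norm_num)).tsum_ofReal_ne_top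
  have hfin := ae_lt_top' (AEMeasurable.tsum
    fun n ↦ (hint n).1.aemeasurable.ennreal_ofReal) hsum
  filter_upwards [hfin] with ω hω
  have h1 := ENNReal.tendsto_atTop_zero_of_tsum_ne_top hω.ne
  rw [← ENNReal.ofReal_zero] at h1
  have h2 := (ENNReal.tendsto_toReal ENNReal.ofReal_ne_top).comp h1
  have h3 := h2.pow 2
  simp only [Function.comp_def, ENNReal.toReal_ofReal (Real.exp_pos _).le, ENNReal.ofReal_zero,
    ENNReal.toReal_zero, ← Real.exp_nat_mul] at h3
  convert h3 using 2
  · push_cast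
    ring_nf
  · norm_num

end Stochastic

/-! ### `B` is a Brownian motion for the right-continuous filtration -/

/-- Independence of a σ-algebra passes to pointwise limits of random variables. -/
lemma indep_comap_of_tendsto {Ω : Type*} {m m₀ : MeasurableSpace Ω} {P : Measure Ω}
    [IsProbabilityMeasure P] {D : Ω → ℝ} {Dn : ℕ → Ω → ℝ} (hD : Measurable[m₀] D)
    (hDn : ∀ n, Measurable[m₀] (Dn n))
    (hlim : ∀ ω, Filter.Tendsto (fun n ↦ Dn n ω) Filter.atTop (nhds (D ω)))
    (hind : ∀ n, Indep (MeasurableSpace.comap (Dn n) inferInstance) m P) :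
    Indep (MeasurableSpace.comap D inferInstance) m P := by
  rw [Indep_iff]
  rintro _ A ⟨S, hS, rfl⟩ hA
  have key : (P.restrict A).map D = P A • P.map D := by
    have : IsFiniteMeasure (P A • P.map D) :=
      Measure.smul_finite _ (measure_ne_top P A)
    refine ext_of_forall_integral_eq_of_IsFiniteMeasure fun f ↦ ?_
    have hlim' (μ : Measure Ω) [IsFiniteMeasure μ] : Filter.Tendsto (fun n ↦ ∫ ω, f (Dn n ω) ∂μ)
        Filter.atTop (nhds (∫ ω, f (D ω) ∂μ)) :=
      tendsto_integral_of_dominated_convergence (fun _ ↦ ‖f‖)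
        (fun n ↦ (f.continuous.measurable.comp (hDn n)).aestronglyMeasurable)
        (integrable_const _) (fun n ↦ ae_of_all _ fun ω ↦ f.norm_coe_le_norm _)
        (ae_of_all _ fun ω ↦ (f.continuous.tendsto _).comp (hlim ω))
    have heq (n : ℕ) : ∫ ω, f (Dn n ω) ∂(P.restrict A) = (P A).toReal * ∫ ω, f (Dn n ω) ∂P := by
      have hmap : (P.restrict A).map (Dn n) = P A • P.map (Dn n) := by
        refine Measure.ext fun S hS ↦ ?_
        rw [Measure.map_apply (hDn n) hS, Measure.restrict_apply (hDn n hS), Measure.smul_apply,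
          Measure.map_apply (hDn n) hS, (Indep_iff _ _ _).1 (hind n) _ A ⟨S, hS, rfl⟩ hA,
          smul_eq_mul, mul_comm]
      rw [← integral_map (hDn n).aemeasurable f.continuous.aestronglyMeasurable,
        hmap, integral_smul_measure,
        integral_map (hDn n).aemeasurable f.continuous.aestronglyMeasurable, smul_eq_mul]
    rw [integral_map hD.aemeasurable f.continuous.aestronglyMeasurable, integral_smul_measure,
      integral_map hD.aemeasurable f.continuous.aestronglyMeasurable, smul_eq_mul]
    refine tendsto_nhds_unique (hlim' (P.restrict A)) ?_
    simp_rw [heq]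
    exact (hlim' P).const_mul _
  have := congrArg (fun μ ↦ μ S) key
  rwa [Measure.map_apply hD hS, Measure.restrict_apply (hD hS), Measure.smul_apply,
    Measure.map_apply hD hS, smul_eq_mul, mul_comm] at this

lemma measurable_eval (t : ℝ≥0) : Measurable fun x : PathSpace ↦ x t :=
  (continuous_eval_const t).measurable

lemma measurable_B (t : ℝ≥0) : Measurable (B t) := (measurable_eval t).comp measurable_fst

lemma continuous_B (ω : Omega) : Continuous (B · ω) := ω.1.continuous

lemma sigmaUpTo_le_filtration (t : ℝ≥0) : sigmaUpTo t ≤ filtration t :=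
  le_iInf₂ fun _ _ ↦ sigmaUpTo_mono le_self_add

lemma filtration_le_sigmaUpTo {t u : ℝ≥0} (htu : t < u) : filtration t ≤ sigmaUpTo u := by
  refine (iInf₂_le (u - t) (tsub_pos_of_lt htu)).trans ?_
  rw [add_tsub_cancel_of_le htu.le]

lemma measurable_R_filtration (t : ℝ≥0) : Measurable[filtration t] R :=
  Measurable.of_comap_le (le_sup_left.trans (sigmaUpTo_le_filtration t))

lemma adapted_B : Adapted filtration B := fun t ↦ by
  refine Measurable.of_comap_le (le_trans ?_ (sigmaUpTo_le_filtration t))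
  exact le_sup_of_le_right (le_iSup₂
    (f := fun (s : ℝ≥0) (_ : s ≤ t) ↦ MeasurableSpace.comap (B s) inferInstance) t le_rfl)

variable {μW : Measure PathSpace}

lemma IsWienerMeasure.isProbabilityMeasure (hμW : IsWienerMeasure μW) : IsProbabilityMeasure μW :=
  hμW.toIsPreBrownianReal.isGaussianProcess.isProbabilityMeasure

lemma IsWienerMeasure.isBrownianReal_B (hμW : IsWienerMeasure μW) :
    IsBrownianReal B (productMeasure μW) := by
  have := hμW.isProbabilityMeasure
  have hfst : HasLaw Prod.fst μW (productMeasure μW) := measurePreserving_fst.hasLaw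
  exact ⟨⟨fun J ↦ (hμW.hasLaw J).comp hfst⟩, ae_of_all _ continuous_B⟩

/-- The σ-algebra on the path space generated by the coordinates up to time `u`. -/
abbrev pathPast (u : ℝ≥0) : MeasurableSpace PathSpace :=
  MeasurableSpace.comap (fun x (s : Set.Iic u) ↦ x s.1) MeasurableSpace.pi

/-- The increment of `B` after `u` is independent of the path up to `u` and of the independent
randomization `R`. -/
lemma IsWienerMeasure.indep_sigmaUpTo (hμW : IsWienerMeasure μW) {u t : ℝ≥0} (hut : u ≤ t) :
    Indep (MeasurableSpace.comap (fun ω ↦ B t ω - B u ω) inferInstance) (sigmaUpTo u)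
      (productMeasure μW) := by
  have := hμW.isProbabilityMeasure
  have : IsProbabilityMeasure (productMeasure μW) := by
    unfold productMeasure; infer_instance
  have hpast : pathPast u ≤ (inferInstance : MeasurableSpace PathSpace) :=
    (measurable_pi_iff.2 fun s : Set.Iic u ↦ measurable_eval s.1).comap_le
  have hpath : Indep (MeasurableSpace.comap (fun x : PathSpace ↦ x t - x u) inferInstance) (pathPast u)
      μW := by
    have h1 : IndepFun (fun (x : PathSpace) ↦ x t - x u) (fun x (s : Set.Iic u) ↦ x s.1) μW := by
      have := (hμW.toIsPreBrownianReal.indepFun_shift u).comp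
        (measurable_pi_apply (t - u)) measurable_id
      simpa only [Function.comp_def, id_eq, add_tsub_cancel_of_le hut] using this
    exact h1
  have hle : sigmaUpTo u ≤ @Prod.instMeasurableSpace _ _ (pathPast u) inferInstance := by
    refine sup_le (le_sup_right (a := (pathPast u).comap Prod.fst)) (iSup₂_le fun s hs ↦ ?_)
    refine le_sup_of_le_left ?_
    have hBs : MeasurableSpace.comap (B s) inferInstance =
        (MeasurableSpace.comap (fun x : PathSpace ↦ x s) inferInstance).comap Prod.fst  := by
      rw [MeasurableSpace.comap_comp]
      rfl
    rw [hBs]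
    have hpi : Measurable fun y : Set.Iic u → ℝ ↦ y ⟨s, hs⟩ := measurable_pi_apply _
    exact MeasurableSpace.comap_mono (hpi.comp (comap_measurable
      (fun (x : PathSpace) (s : Set.Iic u) ↦ x s.1))).comap_le
  refine indep_of_indep_of_le_right (m₂ := @Prod.instMeasurableSpace _ _ (pathPast u) inferInstance) ?_ hle
  have hD : Measurable fun x : PathSpace ↦ x t - x u :=
    (measurable_eval t).sub (measurable_eval u)
  refine IndepSets.indep
    (((measurable_B t).sub (measurable_B u)).comap_le) ?_
    (@MeasurableSpace.isPiSystem_measurableSet _ (MeasurableSpace.comap _ _))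
    (@isPiSystem_prod _ _ (pathPast u) inferInstance)
    (@MeasurableSpace.generateFrom_measurableSet _ (MeasurableSpace.comap _ _)).symm
    (@generateFrom_prod _ _ (pathPast u) inferInstance).symm ?_
  · exact sup_le_sup (MeasurableSpace.comap_mono hpast) le_rfl
  · rw [IndepSets_iff]
    rintro _ _ ⟨S, hS, rfl⟩ ⟨A, hA, C, hC, rfl⟩
    have h1 : (fun ω ↦ B t ω - B u ω) ⁻¹' S =
        ((fun x : PathSpace ↦ x t - x u) ⁻¹' S) ×ˢ (Set.univ : Set I) := by
      ext ω
      simp [B]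
    rw [h1, Set.prod_inter_prod, Set.univ_inter, productMeasure, Measure.prod_prod,
      Measure.prod_prod, Measure.prod_prod, measure_univ, mul_one,
      (Indep_iff _ _ _).1 hpath _ A ⟨S, hS, rfl⟩ hA, mul_assoc]

lemma IsWienerMeasure.isBrownianWrt (hμW : IsWienerMeasure μW) :
    IsBrownianWrt B filtration (productMeasure μW) := by
  have := hμW.isProbabilityMeasure
  have : IsProbabilityMeasure (productMeasure μW) := by
    unfold productMeasure; infer_instance
  refine ⟨hμW.isBrownianReal_B, adapted_B, fun s t hst ↦ ?_⟩
  let ε : ℕ → ℝ≥0 := fun n ↦ 1 / (n + 1)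
  have hε : Filter.Tendsto ε Filter.atTop (nhds 0) :=
    tendsto_one_div_add_atTop_nhds_zero_nat
  have hε0 (n : ℕ) : 0 < ε n := by positivity
  have hlim (ω : Omega) (r : ℝ≥0) :
      Filter.Tendsto (fun n ↦ B (r + ε n) ω) Filter.atTop (nhds (B r ω)) := by
    refine ((continuous_B ω).tendsto r).comp ?_
    simpa using tendsto_const_nhds.add hε
  -- `𝓕 s` sees strictly beyond time `s`, so the increment is first moved to start at `s + ε`.
  refine indep_comap_of_tendsto (Dn := fun n ω ↦ B (t + ε n) ω - B (s + ε n) ω)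
    ((measurable_B t).sub (measurable_B s))
    (fun n ↦ (measurable_B _).sub (measurable_B _)) (fun ω ↦ (hlim ω t).sub (hlim ω s)) fun n ↦ ?_
  exact indep_of_indep_of_le_right (hμW.indep_sigmaUpTo (by gcongr))
    (filtration_le_sigmaUpTo (lt_add_of_pos_right s (hε0 n)))

/-! ### The law of `Y` at the exit from a fixed interval -/

lemma continuous_Y (ω : Omega) : Continuous (Y · ω) :=
  Real.continuous_exp.comp ((continuous_B ω).sub (by fun_prop))

lemma measurable_Y (t : ℝ≥0) : Measurable (Y t) :=
  Real.measurable_exp.comp ((measurable_B t).sub_const _)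

lemma adapted_ofReal_Y : Adapted filtration fun t ω ↦ ENNReal.ofReal (Y t ω) := fun t ↦
  ENNReal.measurable_ofReal.comp (Real.measurable_exp.comp ((adapted_B t).sub_const _))

lemma Y_pos (t : ℝ≥0) (ω : Omega) : 0 < Y t ω := Real.exp_pos _

lemma continuous_ofReal_Y (ω : Omega) : Continuous fun t ↦ ENNReal.ofReal (Y t ω) :=
  ENNReal.continuous_ofReal.comp (continuous_Y ω)

lemma measurable_stoppedY {τ : Omega → WithTop ℝ≥0} (hτ : Measurable τ) :
    Measurable (stoppedY τ) := by
  refine Measurable.ite (hτ (measurableSet_singleton ⊤)) measurable_const ?_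
  have hY : Measurable (Function.uncurry Y) :=
    measurable_uncurry_of_continuous_of_measurable continuous_Y measurable_Y
  exact hY.comp ((WithTop.measurable_untopA.comp hτ).prodMk measurable_id)

lemma stoppedY_of_eq_top {τ : Omega → WithTop ℝ≥0} {ω : Omega} (h : τ ω = ⊤) :
    stoppedY τ ω = 0 := if_pos h

lemma stoppedY_of_eq_coe {τ : Omega → WithTop ℝ≥0} {ω : Omega} {t : ℝ≥0} (h : τ ω = t) :
    stoppedY τ ω = Y t ω := by
  rw [stoppedY, if_neg (h ▸ WithTop.coe_ne_top), stoppedValue, h]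
  rfl

/-- The exit time of `Y` from the fixed interval `(a, b)`. -/
def constExitTime (a b : ℝ≥0∞) (ω : Omega) : WithTop ℝ≥0 :=
  firstExit (fun t ↦ ENNReal.ofReal (Y t ω)) a b

lemma isStoppingTime_constExitTime (a b : ℝ≥0∞) :
    IsStoppingTime filtration (constExitTime a b) :=
  isStoppingTime_firstExit adapted_ofReal_Y continuous_ofReal_Y measurable_const measurable_const

section ExitLaw

variable {P : Measure Omega} {a b : ℝ≥0∞}

lemma ae_Y_zero (hB : IsBrownianReal B P) : ∀ᵐ ω ∂P, Y 0 ω = 1 := by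
  filter_upwards [hB.toIsPreBrownianReal.eval_zero_ae_eq_zero] with ω hω
  simp [Y, hω]

/-- Before the exit from `(a, b)` with `a > 0`, `Y` stays above `a`, so convergence of `Y` to `0`
forces the exit time to be finite; for `a = 0` the limit `0` at infinity is the lower endpoint. -/
lemma ae_stoppedY_mem (hB : IsBrownianReal B P) (ha : a < 1) (hb : 1 < b) :
    ∀ᵐ ω ∂P, stoppedY (constExitTime a b) ω = a.toReal ∨
      (b ≠ ∞ ∧ stoppedY (constExitTime a b) ω = b.toReal) := by
  filter_upwards [ae_Y_zero hB, ae_tendsto_exp_zero hB] with ω h0 hlim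
  cases hτ : constExitTime a b ω with
  | top =>
    rw [stoppedY_of_eq_top hτ]
    left
    have hmem (t : ℝ≥0) : ENNReal.ofReal (Y t ω) ∈ Set.Ioo a b :=
      mem_Ioo_of_lt_firstExit (f := fun t ↦ ENNReal.ofReal (Y t ω))
        ((WithTop.coe_lt_top t).trans_eq hτ.symm)
    have hle : a.toReal ≤ 0 := by
      refine ge_of_tendsto' hlim fun n ↦ ?_
      have := ENNReal.toReal_mono ENNReal.ofReal_ne_top (hmem n).1.le
      rwa [ENNReal.toReal_ofReal (Y_pos _ _).le] at this
    exact (le_antisymm hle ENNReal.toReal_nonneg).symm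
  | coe t =>
    rw [stoppedY_of_eq_coe hτ]
    have h0' : ENNReal.ofReal (Y 0 ω) ∈ Set.Ioo a b := by
      rw [h0, ENNReal.ofReal_one]
      exact ⟨ha, hb⟩
    rcases eq_or_eq_of_firstExit_eq (continuous_ofReal_Y ω) h0' hτ with h | h
    · left
      rw [← h, ENNReal.toReal_ofReal (Y_pos _ _).le]
    · right
      rw [← h, ENNReal.toReal_ofReal (Y_pos _ _).le]
      exact ⟨ENNReal.ofReal_ne_top, rfl⟩

/-- Up to its exit from `(a, b)` with `b < ∞` the martingale `Y` is bounded, so its mean is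
preserved. -/
lemma integral_stoppedY [IsProbabilityMeasure P] (hB : IsBrownianWrt B filtration P)
    (ha : a < 1) (hb : 1 < b) (hb' : b ≠ ∞) :
    ∫ ω, stoppedY (constExitTime a b) ω ∂P = 1 := by
  let v : ℕ → Omega → ℝ≥0 := fun n ω ↦ (min (constExitTime a b ω) (n : ℝ≥0)).untopA
  have hv (n : ℕ) (ω : Omega) :
      ((v n ω : ℝ≥0) : WithTop ℝ≥0) = min (constExitTime a b ω) (n : ℝ≥0) := by
    have hne : min (constExitTime a b ω) ((n : ℝ≥0) : WithTop ℝ≥0) ≠ ⊤ :=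
      ne_top_of_le_ne_top WithTop.coe_ne_top (min_le_right _ _)
    simp only [v, WithTop.untopA_eq_untop hne, WithTop.coe_untop]
  have hvn (n : ℕ) (ω : Omega) : v n ω ≤ n := by
    have := (hv n ω).le.trans (min_le_right _ _)
    exact_mod_cast this
  have hst (n : ℕ) : IsStoppingTime filtration fun ω ↦ ((v n ω : ℝ≥0) : WithTop ℝ≥0) := by
    simp_rw [hv]
    exact (isStoppingTime_constExitTime a b).min_const _
  have hY0 := ae_Y_zero hB.isBrownian
  have hmean (n : ℕ) : ∫ ω, Y (v n ω) ω ∂P = 1 := by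
    have hM : Martingale Y filtration P := hB.martingale_exp
    rw [integral_stopped_eq hM continuous_Y (hst n) (hvn n),
      ← integral_stopped_eq hM continuous_Y (v := fun _ ↦ 0) (isStoppingTime_const _ _)
        (fun _ ↦ bot_le), integral_congr_ae hY0]
    simp
  have hbound (n : ℕ) : ∀ᵐ ω ∂P, ‖Y (v n ω) ω‖ ≤ b.toReal := by
    filter_upwards [hY0] with ω h0
    rw [Real.norm_of_nonneg (Y_pos _ _).le, ← ENNReal.ofReal_le_iff_le_toReal hb']
    have h0' : ENNReal.ofReal (Y 0 ω) ∈ Set.Ioo a b := by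
      rw [h0, ENNReal.ofReal_one]
      exact ⟨ha, hb⟩
    rcases ((hv n ω).le.trans (min_le_left _ _)).lt_or_eq with h | h
    · exact (mem_Ioo_of_lt_firstExit h).2.le
    · rcases eq_or_eq_of_firstExit_eq (continuous_ofReal_Y ω) h0' h.symm with h | h
      · rw [h]; exact (ha.trans hb).le
      · rw [h]
  have hlim : ∀ᵐ ω ∂P, Filter.Tendsto (fun n ↦ Y (v n ω) ω) Filter.atTop
      (nhds (stoppedY (constExitTime a b) ω)) := by
    filter_upwards [ae_tendsto_exp_zero hB.isBrownian] with ω hω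
    cases hτ : constExitTime a b ω with
    | top =>
      rw [stoppedY_of_eq_top hτ]
      have hvn (n : ℕ) : v n ω = n := by
        have := hv n ω
        rw [hτ, min_eq_right le_top] at this
        exact_mod_cast this
      simp_rw [hvn]
      exact hω
    | coe t =>
      rw [stoppedY_of_eq_coe hτ]
      obtain ⟨N, hN⟩ := exists_nat_ge t
      refine tendsto_const_nhds.congr' ?_
      filter_upwards [Filter.eventually_ge_atTop N] with n hn
      have : v n ω = t := by
        have := hv n ω
        have htn : t ≤ n := hN.trans (by exact_mod_cast hn)
        rw [hτ, min_eq_left (by exact_mod_cast htn)] at this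
        exact_mod_cast this
      rw [this]
  have hmeas (n : ℕ) : AEStronglyMeasurable (fun ω ↦ Y (v n ω) ω) P := by
    have : (fun ω ↦ Y (v n ω) ω) = stoppedY fun ω ↦ ((v n ω : ℝ≥0) : WithTop ℝ≥0) := by
      ext ω
      rw [stoppedY_of_eq_coe rfl]
    rw [this]
    exact (measurable_stoppedY (hst n).measurable').aestronglyMeasurable
  have := tendsto_integral_of_dominated_convergence _ hmeas (integrable_const b.toReal) hbound hlim
  simp_rw [hmean] at this
  exact tendsto_nhds_unique this tendsto_const_nhds

lemma lintegral_comp_stoppedY [IsProbabilityMeasure P] (hB : IsBrownianWrt B filtration P)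
    (hab : LevelsOK a b) {f : ℝ → ℝ≥0∞} :
    ∫⁻ ω, f (stoppedY (constExitTime a b) ω) ∂P = exitMean f a b := by
  rcases hab with ⟨rfl, rfl⟩ | ⟨ha, hb⟩
  · have : ∀ᵐ ω ∂P, f (stoppedY (constExitTime 1 1) ω) = f 1 := by
      filter_upwards [ae_Y_zero hB.isBrownian] with ω hω
      have hτ : constExitTime 1 1 ω = (0 : ℝ≥0) := firstExit_eq_zero (by simp)
      rw [stoppedY_of_eq_coe hτ, hω]
    rw [lintegral_congr_ae this]
    simp [exitMean]
  have hmem := ae_stoppedY_mem hB.isBrownian ha hb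
  by_cases hb' : b = ∞
  · have : ∀ᵐ ω ∂P, f (stoppedY (constExitTime a b) ω) = f a.toReal := by
      filter_upwards [hmem] with ω hω
      rw [hω.resolve_right fun h ↦ h.1 hb']
    rw [lintegral_congr_ae this]
    simp [exitMean, ha.ne, hb']
  rw [exitMean, if_neg ha.ne, if_neg hb']
  have hmean := integral_stoppedY hB ha hb hb'
  have hSm : Measurable (stoppedY (constExitTime a b)) :=
    measurable_stoppedY (isStoppingTime_constExitTime a b).measurable'
  lift b to ℝ≥0 using hb'
  lift a to ℝ≥0 using ha.ne_top
  norm_cast at ha hb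
  set S := stoppedY (constExitTime a b) with hS
  set A : Set Omega := S ⁻¹' {(b : ℝ)} with hA
  have hAm : MeasurableSet A := hSm (measurableSet_singleton _)
  have hab : a < b := ha.trans hb
  have hab' : (a : ℝ) < b := by exact_mod_cast hab
  have hon : ∀ ω ∈ A, S ω = b := fun ω hω ↦ hω
  have hoff : ∀ᵐ ω ∂P, ω ∈ Aᶜ → S ω = a := by
    filter_upwards [hmem] with ω hω hωA
    exact hω.resolve_right fun h ↦ hωA h.2
  -- The probability `p` of leaving through `b` is determined by `a (1 - p) + b p = 1`.
  have hp : P.real A = (1 - a) / (b - a) := by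
    have h1 : ∀ᵐ ω ∂P, S ω = a + A.indicator (fun _ ↦ (b - a : ℝ)) ω := by
      filter_upwards [hoff] with ω hω
      by_cases h : ω ∈ A
      · simp [h, hon ω h]
      · simp [h, hω h]
    rw [integral_congr_ae h1, integral_add (integrable_const _)
      ((integrable_const _).indicator hAm), integral_indicator_const _ hAm] at hmean
    simp only [integral_const, probReal_univ, smul_eq_mul, one_mul] at hmean
    rw [eq_div_iff (by linarith)]
    linarith
  have hpA : P A = (1 - a) / (b - a) := by
    have : P.real A = ((1 - a) / (b - a) : ℝ≥0) := by
      rw [hp, NNReal.coe_div, NNReal.coe_sub ha.le, NNReal.coe_sub hab.le, NNReal.coe_one]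
    rw [measureReal_def] at this
    rw [← ENNReal.ofReal_toReal (measure_ne_top P A), this, ENNReal.ofReal_coe_nnreal,
      ENNReal.coe_div (tsub_pos_of_lt hab).ne']
    push_cast
    rfl
  have hpAc : P Aᶜ = (b - 1) / (b - a) := by
    have hsum := div_add_div_eq_one (a := (a : ℝ≥0∞)) (b := b) (by exact_mod_cast ha)
      (by exact_mod_cast hb) ENNReal.coe_lt_top
    rw [prob_compl_eq_one_sub hAm, hpA]
    refine ENNReal.sub_eq_of_eq_add (hpA ▸ measure_ne_top P A) hsum.symm
  rw [← lintegral_add_compl _ hAm, setLIntegral_congr_fun hAm (g := fun _ ↦ f b)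
    (fun ω hω ↦ by rw [hon ω hω]), setLIntegral_congr_fun_ae hAm.compl (g := fun _ ↦ f a)
    (by filter_upwards [hoff] with ω hω h using by rw [hω h]), setLIntegral_const,
    setLIntegral_const, hpA, hpAc, add_comm]
  simp [mul_comm]

end ExitLaw

/-! ### Randomization of the levels -/

lemma IsAdmissible.isStoppingTime_exitTime (hν : IsAdmissible ν) :
    IsStoppingTime filtration (exitTime ν) := by
  have hR : Measurable[filtration 0] fun ω ↦ (R ω : ℝ) :=
    measurable_subtype_coe.comp (measurable_R_filtration 0)
  exact isStoppingTime_firstExit adapted_ofReal_Y continuous_ofReal_Y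
    (hν.measurable_U.comp hR) (hν.measurable_V.comp hR)

lemma lintegral_unitInterval {f : ℝ → ℝ≥0∞} :
    ∫⁻ r : I, f r = ∫⁻ r in Set.Ioo 0 1, f r := by
  rw [unitInterval.measurePreserving_coe.lintegral_comp_emb
    (MeasurableEmbedding.subtype_coe measurableSet_Icc) f]
  exact (setLIntegral_congr Ioo_ae_eq_Icc).symm

/-- `Y_τ` depends on the second coordinate only through the time `τ`. -/
lemma stoppedY_congr {τ ρ : Omega → WithTop ℝ≥0} {x : PathSpace} {r r' : I}
    (h : τ (x, r) = ρ (x, r')) : stoppedY τ (x, r) = stoppedY ρ (x, r') := by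
  simp only [stoppedY, stoppedValue, h]
  rfl

lemma exitTime_eq_constExitTime (x : PathSpace) (r : I) :
    exitTime ν (x, r) = constExitTime (U ν r) (V ν r) (x, r) := rfl

lemma constExitTime_congr (a b : ℝ≥0∞) (x : PathSpace) (r r' : I) :
    constExitTime a b (x, r) = constExitTime a b (x, r') := rfl

lemma IsWienerMeasure.lintegral_path (hμW : IsWienerMeasure μW) {a b : ℝ≥0∞}
    (hab : LevelsOK a b) {f : ℝ → ℝ≥0∞} (hf : Measurable f) (r : I) :
    ∫⁻ x, f (stoppedY (constExitTime a b) (x, r)) ∂μW = exitMean f a b := by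
  have := hμW.isProbabilityMeasure
  have : IsProbabilityMeasure (productMeasure μW) := by
    unfold productMeasure; infer_instance
  have hm : Measurable fun ω ↦ f (stoppedY (constExitTime a b) ω) :=
    hf.comp (measurable_stoppedY (isStoppingTime_constExitTime a b).measurable')
  rw [← lintegral_comp_stoppedY hμW.isBrownianWrt hab, productMeasure,
    lintegral_prod_symm _ hm.aemeasurable]
  -- For constant levels the path integral does not depend on the second coordinate.
  have (r' : I) : ∫⁻ x, f (stoppedY (constExitTime a b) (x, r')) ∂μW =
      ∫⁻ x, f (stoppedY (constExitTime a b) (x, r)) ∂μW :=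
    lintegral_congr fun x ↦ by rw [stoppedY_congr (constExitTime_congr a b x r' r)]
  simp_rw [this, lintegral_const, measure_univ, mul_one]

lemma IsAdmissible.lintegral_stoppedY (hν : IsAdmissible ν) (hμW : IsWienerMeasure μW)
    {f : ℝ → ℝ≥0∞} (hf : Measurable f) (hf1 : ∀ x, f x ≤ 1) :
    ∫⁻ ω, f (stoppedY (exitTime ν) ω) ∂(productMeasure μW) = ∫⁻ x, f x ∂ν := by
  have := hμW.isProbabilityMeasure
  have hm : Measurable fun ω ↦ f (stoppedY (exitTime ν) ω) :=
    hf.comp (measurable_stoppedY hν.isStoppingTime_exitTime.measurable')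
  rw [productMeasure, lintegral_prod_symm _ hm.aemeasurable, ← hν.lintegral_exitMean hf hf1,
    ← lintegral_unitInterval]
  have hok : ∀ᵐ r : I, LevelsOK (U ν r) (V ν r) := by
    have h1 : ∀ᵐ r ∂(volume.restrict I), LevelsOK (U ν r) (V ν r) := by
      rw [← Measure.restrict_congr_set Ioo_ae_eq_Icc]
      exact hν.ae_levelsOK
    exact unitInterval.measurePreserving_coe.quasiMeasurePreserving.ae h1
  refine lintegral_congr_ae ?_
  filter_upwards [hok] with r hr
  rw [← hμW.lintegral_path hr hf r]
  exact lintegral_congr fun x ↦ by rw [stoppedY_congr (exitTime_eq_constExitTime x r)]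

lemma IsAdmissible.map_stoppedY (hν : IsAdmissible ν) (hμW : IsWienerMeasure μW) :
    (productMeasure μW).map (stoppedY (exitTime ν)) = ν := by
  have hm := measurable_stoppedY hν.isStoppingTime_exitTime.measurable'
  refine Measure.ext fun S hS ↦ ?_
  have h1 := hν.lintegral_stoppedY hμW (f := S.indicator 1) (measurable_one.indicator hS)
    fun x ↦ Set.indicator_le_self' (by simp) x
  rw [lintegral_indicator_one hS] at h1
  rw [← h1, Measure.map_apply hm hS, ← lintegral_indicator_one (hm hS)]
  rfl

lemma isAdmissible_map {Ω' : Type*} [MeasurableSpace Ω'] {P' : Measure Ω'}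
    [IsProbabilityMeasure P'] {ξ : Ω' → ℝ} (hξ : AEMeasurable ξ P') (h0 : ∀ᵐ ω ∂P', 0 ≤ ξ ω)
    (h1 : ∫⁻ ω, ENNReal.ofReal (ξ ω) ∂P' ≤ 1) : IsAdmissible (P'.map ξ) where
  isProbabilityMeasure := Measure.isProbabilityMeasure_map hξ
  nonneg := (ae_map_iff hξ measurableSet_Ici).2 h0
  mean_le_one := by rwa [lintegral_map' ENNReal.measurable_ofReal.aemeasurable hξ]

end GBMEmbedding

end

theorem lemma2p1
    {Ω' : Type*} [MeasurableSpace Ω'] (P' : Measure Ω') [IsProbabilityMeasure P']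
    (ξ : Ω' → ℝ) (hξ : AEMeasurable ξ P') (hξ_nonneg : ∀ᵐ ω ∂P', 0 ≤ ξ ω)
    (hξ_mean : ∫⁻ ω, ENNReal.ofReal (ξ ω) ∂P' ≤ 1)
    (μW : Measure GBMEmbedding.PathSpace) (hμW : GBMEmbedding.IsWienerMeasure μW) :
    -- `R` is `𝓕_0`-measurable and uniform on `[0, 1]`
    Measurable[GBMEmbedding.filtration 0] GBMEmbedding.R ∧
    HasLaw GBMEmbedding.R volume (GBMEmbedding.productMeasure μW) ∧
    -- `B` is an `(𝓕_t, P)`-Brownian motion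
    GBMEmbedding.IsBrownianWrt GBMEmbedding.B GBMEmbedding.filtration
      (GBMEmbedding.productMeasure μW) ∧
    -- the exit time `τ` of `Y` from `(α, β)` is an `(𝓕_t)`-stopping time
    IsStoppingTime GBMEmbedding.filtration (GBMEmbedding.exitTime (P'.map ξ)) ∧
    -- `Y_τ ∼ ξ`
    IdentDistrib (GBMEmbedding.stoppedY (GBMEmbedding.exitTime (P'.map ξ))) ξ
      (GBMEmbedding.productMeasure μW) P' := by
  have hν := GBMEmbedding.isAdmissible_map hξ hξ_nonneg hξ_mean
  have := hμW.isProbabilityMeasure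
  refine ⟨GBMEmbedding.measurable_R_filtration 0, measurePreserving_snd.hasLaw,
    hμW.isBrownianWrt, hν.isStoppingTime_exitTime, ?_, hξ, hν.map_stoppedY hμW⟩
  exact (GBMEmbedding.measurable_stoppedY
    hν.isStoppingTime_exitTime.measurable').aemeasurable
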